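/- Let $n,m\ge 1$ be integers and let $S^n=\{(x,0): |x|=1\}\subset\mathbb{R}^{n+1}\times\mathbb{R}^{m+1}=\mathbb{R}^{n+m+2}$. Fix $w>0$, let $\mu$ be $w$ times the surface measure of $S^n$, and for $\epsilon>0$ let $$M=\mathbb{R}^{n+m+2}\setminus S^n,\qquad U(p)=1+\epsilon\int_{S^n}|p-q|^{-(n+m)}\,d\mu(q),\qquad g=U^{4/(n+m)}\,\delta .$$ Say that a Riemannian manifold has \emph{positive ends} if it has at least two ends and each end has an open neighbourhood foliated by compact smooth hypersurfaces (the level sets of a smooth submersion growing towards the end) whose mean curvature with respect to the unit normal pointing towards that end is positive. Here the mean curvature with respect to a unit normal $\nu$ is the trace of $v\mapsto\nabla_v\nu$, so that a round sphere of radius $R$ in $\mathbb{R}^N$ has mean curvature $(N-1)/R$ for the outward normal. Let $T_r=\{(x,y):(|x|-1)^2+|y|^2=r^2\}$ be the tube of radius $r$ around $S^n$, and put $$\kappa=\int_{\mathbb{R}^n}(1+|z|^2)^{-(n+m)/2}\,dz,\qquad C=\kappa\,\frac{(m-1)(n+m)+2m}{(m+1)(n+m)}>0 .$$ Then: (1)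 For every $\epsilon>0$, $g$ is a smooth Riemannian metric on $M$ and $(M,g)$ has positive ends. (2) For every $\theta$ with $0<\theta<wC$ there is $\epsilon_0>0$ such that for all $0<\epsilon<\epsilon_0$ and all $0<r<(\theta\epsilon)^{1/m}$ the tube $T_r$ is a compact smooth hypersurface of $M$, homeomorphic to $S^n\times S^{m+1}$, whose mean curvature in $(M,g)$ with respect to the unit normal pointing towards the missing sphere $S^n$ is everywhere positive. (In particular the range $0<r<\epsilon^{1/m}$ is admissible whenever $wC>1$.) (3) There are $R_0$ and $\epsilon_0>0$ such that for all $0<\epsilon<\epsilon_0$ and all $R>R_0$ the coordinate sphere $\{|p|=R\}$ is a compact smooth hypersurface of $M$ whose mean curvature in $(M,g)$ with respect to the unit normal pointing to infinity is everywhere positive. -/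

import Mathlib

open scoped ContDiff

noncomputable section

namespace PositiveEnds

section Riemannian

variable {E : Type*} [NormedAddCommGroup E] [NormedSpace ℝ E]

/-- `g` is a smooth Riemannian metric on the open set `Ω`. -/
structure IsRiemannianMetricOn (g : E → E →L[ℝ] E →L[ℝ] ℝ) (Ω : Set E) : Prop where
  isOpen : IsOpen Ω
  smooth : ContDiffOn ℝ ∞ g Ω
  symm : ∀ p ∈ Ω, ∀ v w : E, g p v w = g p w v
  pos : ∀ p ∈ Ω, ∀ v : E, v ≠ 0 → 0 < g p v v

/-- The `g`-gradient of `φ`: the vector representing `dφ` through the metric. -/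
def gradient (g : E → E →L[ℝ] E →L[ℝ] ℝ) (φ : E → ℝ) (p : E) : E :=
  (g p).inverse (fderiv ℝ φ p)

/-- The `g`-unit normal field of the level sets of `φ`, pointing to the side where `φ` grows. -/
def unitNormal (g : E → E →L[ℝ] E →L[ℝ] ℝ) (φ : E → ℝ) (p : E) : E :=
  (Real.sqrt (g p (gradient g φ p) (gradient g φ p)))⁻¹ • gradient g φ p

/-- The Christoffel form `w ↦ ½ ((D_v g)(u, w) + (D_u g)(v, w) - (D_w g)(v, u))`. -/
def christoffelForm (g : E → E →L[ℝ] E →L[ℝ] ℝ) (p v u : E) : E →L[ℝ] ℝ :=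
  (1 / 2 : ℝ) • (fderiv ℝ g p v u + fderiv ℝ g p u v - ((fderiv ℝ g p).flip v).flip u)

/-- The covariant derivative `v ↦ ∇_v X` at `p` for the Levi-Civita connection of `g`. -/
def covariantDerivative (g : E → E →L[ℝ] E →L[ℝ] ℝ) (X : E → E) (p : E) : E →ₗ[ℝ] E where
  toFun v := fderiv ℝ X p v + (g p).inverse (christoffelForm g p v (X p))
  map_add' v w := by
    have h : christoffelForm g p (v + w) (X p)
        = christoffelForm g p v (X p) + christoffelForm g p w (X p) := by
      ext z
      simp [christoffelForm]
      ring
    rw [h, map_add, map_add]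
    abel
  map_smul' a v := by
    have h : christoffelForm g p (a • v) (X p) = a • christoffelForm g p v (X p) := by
      ext z
      simp [christoffelForm]
      ring
    rw [h, map_smul, map_smul, smul_add]
    rfl

/-- The mean curvature at `p` of the level set of `φ` through `p`, with respect to the unit
normal `ν` pointing to the side where `φ` grows: the trace of `v ↦ ∇_v ν` (a round sphere of
radius `R` in Euclidean `N`-space has mean curvature `(N - 1) / R` for the outward normal).
As `ν` is a unit field near `p`, `∇_v ν` is orthogonal to `ν`, so that the trace over the whole
space is the trace over the tangent space of the level set. -/
def meanCurvature (g : E → E →L[ℝ] E →L[ℝ] ℝ) (φ : E → ℝ) (p : E) : ℝ :=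
  LinearMap.trace ℝ E (covariantDerivative g (unitNormal g φ) p)

/-- `S` is a compact smooth hypersurface in `Ω` which locally bounds the region `D`, and the mean
curvature of `S` with respect to the unit normal pointing into `D` is everywhere positive.
The mean curvature at `p` does not depend on the local defining function `φ`. -/
structure IsPositiveHypersurface (g : E → E →L[ℝ] E →L[ℝ] ℝ) (Ω S D : Set E) : Prop where
  subset : S ⊆ Ω
  isCompact : IsCompact S
  positive : ∀ p ∈ S, ∃ (V : Set E) (φ : E → ℝ), IsOpen V ∧ p ∈ V ∧ ContDiffOn ℝ ∞ φ V ∧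
    (∀ q ∈ V, fderiv ℝ φ q ≠ 0) ∧ (∀ q ∈ V, q ∈ S ↔ φ q = 0) ∧ (∀ q ∈ V, q ∈ D ↔ 0 < φ q) ∧
    0 < meanCurvature g φ p

/-- An end of `Ω` (in the sense of Freudenthal): a compatible choice of a connected component of
`Ω \ K` for every compact `K ⊆ Ω`. -/
@[ext] structure SpaceEnd (Ω : Set E) where
  comp : {K : Set E // IsCompact K ∧ K ⊆ Ω} → Set E
  isComponent : ∀ K, ∃ x ∈ Ω \ K.1, comp K = connectedComponentIn (Ω \ K.1) x
  anti : ∀ K L, K.1 ⊆ L.1 → comp L ⊆ comp K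

/-- `W` is a neighbourhood of the end `e`. -/
def SpaceEnd.IsNhd {Ω : Set E} (e : SpaceEnd Ω) (W : Set E) : Prop :=
  ∃ K, e.comp K ⊆ W

/-- An open neighbourhood `V` of the end `e` is foliated by the level sets of a smooth submersion
`f`, which grows towards the end, and all leaves are compact smooth hypersurfaces with positive
mean curvature with respect to the unit normal pointing towards the end. -/
def SpaceEnd.IsPositive {Ω : Set E} (g : E → E →L[ℝ] E →L[ℝ] ℝ) (e : SpaceEnd Ω) : Prop :=
  ∃ (V : Set E) (f : E → ℝ), IsOpen V ∧ V ⊆ Ω ∧ e.IsNhd V ∧ ContDiffOn ℝ ∞ f V ∧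
    (∀ p ∈ V, fderiv ℝ f p ≠ 0) ∧
    ∀ t ∈ f '' V, e.IsNhd {p | p ∈ V ∧ t < f p} ∧
      IsPositiveHypersurface g Ω {p | p ∈ V ∧ f p = t} {p | p ∈ V ∧ t < f p}

/-- `(Ω, g)` has two or more ends, and each of them is foliated by compact smooth hypersurfaces
with positive mean curvature. -/
def HasPositiveEnds (Ω : Set E) (g : E → E →L[ℝ] E →L[ℝ] ℝ) : Prop :=
  Nontrivial (SpaceEnd Ω) ∧ ∀ e : SpaceEnd Ω, e.IsPositive g

end Riemannian

/-- Euclidean space `ℝ^(n+m+2) = ℝ^(n+1) × ℝ^(m+1)`. -/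
abbrev Space (n m : ℕ) : Type :=
  WithLp 2 (EuclideanSpace ℝ (Fin (n + 1)) × EuclideanSpace ℝ (Fin (m + 1)))

/-- The sphere `S^n × {0}`. -/
def removedSphere (n m : ℕ) : Set (Space n m) := {p | ‖p.fst‖ = 1 ∧ p.snd = 0}

/-- The manifold `M = ℝ^(n+m+2) \ S^n`. -/
def manifold (n m : ℕ) : Set (Space n m) := (removedSphere n m)ᶜ

/-- The conformal factor `U(p) = 1 + ε ∫_{S^n} |p - q|^{-(n+m)} dμ(q)`, where `μ` is `w` times the
surface measure of the unit sphere `S^n`. -/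
def conformalFactor (n m : ℕ) (w ε : ℝ) (p : Space n m) : ℝ :=
  1 + ε * (w * ∫ q : Metric.sphere (0 : EuclideanSpace ℝ (Fin (n + 1))) 1,
    (‖p - WithLp.toLp 2 ((q : EuclideanSpace ℝ (Fin (n + 1))),
      (0 : EuclideanSpace ℝ (Fin (m + 1))))‖ ^ (n + m))⁻¹
    ∂(MeasureTheory.volume : MeasureTheory.Measure (EuclideanSpace ℝ (Fin (n + 1)))).toSphere)

/-- The metric `g = U^{4/(n+m)} δ`. -/
def metric (n m : ℕ) (w ε : ℝ) (p : Space n m) : Space n m →L[ℝ] Space n m →L[ℝ] ℝ :=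
  (conformalFactor n m w ε p ^ (4 / ((n : ℝ) + m))) • (innerSL ℝ : Space n m →L[ℝ] Space n m →L[ℝ] ℝ)

/-- The rotationally symmetric set `Σ(γ) = {(x, y) : (|x|, |y|) ∈ γ}`. -/
def rotationSet (n m : ℕ) (γ : Set (ℝ × ℝ)) : Set (Space n m) :=
  {p | (‖p.fst‖, ‖p.snd‖) ∈ γ}

/-- The tube `T_r = Σ(γ_r)` with `γ_r(s) = (1 + r cos (s/r), r sin (s/r))`, `0 ≤ s ≤ π r`. -/
def tube (n m : ℕ) (r : ℝ) : Set (Space n m) :=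
  rotationSet n m
    ((fun s : ℝ => (1 + r * Real.cos (s / r), r * Real.sin (s / r))) '' Set.Icc 0 (Real.pi * r))

/-- The side of `T_r` that contains the end at the missing sphere. -/
def tubeInside (n m : ℕ) (r : ℝ) : Set (Space n m) :=
  {p | p ∈ manifold n m ∧ Metric.infDist p (removedSphere n m) < r}

/-- `κ = ∫_{ℝ^n} (1 + |z|²)^{-(n+m)/2} dz`, the coefficient for which
`∫_{S^n} |p - q|^{-(n+m)} dσ(q) ∼ κ dist(p, S^n)^{-m}` near `S^n`, `σ` the surface measure. -/
def kappa (n m : ℕ) : ℝ :=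
  ∫ z : EuclideanSpace ℝ (Fin n), (1 + ‖z‖ ^ 2) ^ (-(((n : ℝ) + m) / 2))

/-- The constant `κ ((m-1)(n+m) + 2m) / ((m+1)(n+m))`. -/
def tubeConstant (n m : ℕ) : ℝ :=
  kappa n m * ((((m : ℝ) - 1) * (n + m) + 2 * m) / ((m + 1) * (n + m)))

end PositiveEnds

end

/-! Put `k = n + m`, so the ambient dimension is `k + 2`. For `g = U^{4/k} δ` and a level set with
Euclidean gradient field `Z`, the `g`-mean curvature has the sign of `k U h + 2 (k + 1) dU(Z)`,
where `h` is `|Z|` times the Euclidean mean curvature (`meanCurvature_rpow_pos`). Everything reduces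
to comparing `U` with its derivative.

Near the removed sphere let `r` be the distance to it and `P` the potential. Zooming in at scale
`r`, the sphere becomes a flat `ℝ^n`; hence `r^m P → κ`, and the derivative of `P` along the inward
field of length `r`, times `r^m`, stays above a quantity tending to `m κ` (`potential_eq_profile`,
`fderiv_potential_tubeField_ge`, `tendsto_profile`, `japaneseIntegral_add_one`). On `T_r` the inward
`h` tends to `-(m + 1)`. After multiplication by `r^m` the sign condition is, to leading order, `ε w
κ (2 (k + 1) m - k (m + 1)) > k (m + 1) r^m`, that is `r^m < ε w C`. The errors depend only on the
position of `p` near the sphere, not on `ε`; so one radius `δ` serves all `ε`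
(`exists_meanCurvature_tube_pos`).

On a sphere of radius `R` the Euclidean term is `k (k + 1)`, while the radial derivative of `P` is
`O(1/R)`, which settles infinity (`meanCurvature_sphere_pos`).

For the ends, `M` is exhausted by the compact sets of points at distance at least `a` from the
sphere and of norm at most `R`. The complement of each is a punctured tube and a ball exterior, both
connected, so there are exactly two ends, foliated by tubes and by spheres. -/

noncomputable section

namespace PositiveEnds

open Filter Topology MeasureTheory

/-! ### Mean curvature under a conformal change of the Euclidean metric. -/

section ConformalGeometry

variable {E : Type*} [NormedAddCommGroup E] [InnerProductSpace ℝ E]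

variable (E) in
/-- The Euclidean inner product as a bilinear form. -/
def innerForm : E →L[ℝ] E →L[ℝ] ℝ := innerSL ℝ

@[simp]
theorem innerForm_apply (v w : E) : innerForm E v w = inner ℝ v w := rfl

theorem fderiv_ne_zero_of_innerForm {φ : E → ℝ} {p v : E} (hφ : HasFDerivAt φ (innerForm E v) p)
    (hv : v ≠ 0) : fderiv ℝ φ p ≠ 0 := by
  rw [hφ.fderiv]
  intro h
  have h1 := congrArg (fun L : E →L[ℝ] ℝ => L v) h
  simp [hv] at h1

variable [FiniteDimensional ℝ E]

theorem isInvertible_smul_innerSL {c : ℝ} (hc : c ≠ 0) :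
    (c • innerForm E).IsInvertible := by
  have hker : (c • innerForm E).ker = ⊥ := by
    rw [LinearMap.ker_eq_bot']
    intro v hv
    have h := congrArg (fun L : E →L[ℝ] ℝ => L v) hv
    simpa [hc] using h
  have hrange : (c • innerForm E).range = ⊤ := by
    rw [LinearMap.range_eq_top]
    intro L
    obtain ⟨v, rfl⟩ := (InnerProductSpace.toDual ℝ E).surjective L
    refine ⟨c⁻¹ • v, ?_⟩
    ext z
    simp [hc]
  exact ⟨ContinuousLinearEquiv.ofBijective _ hker hrange,
    ContinuousLinearEquiv.coe_ofBijective _ hker hrange⟩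

theorem inverse_smul_innerSL_apply {c : ℝ} (hc : c ≠ 0) (v : E) :
    (c • innerForm E).inverse (innerForm E v) = c⁻¹ • v := by
  rw [(isInvertible_smul_innerSL hc).inverse_apply_eq]
  ext z
  simp [hc]

/-- Here `Z` is the Euclidean gradient of `φ`. Keeping the radicand as one product `λ |Z|²` lets the
normal be differentiated later as a single composition with `x ↦ (√x)⁻¹`. -/
theorem unitNormal_conformal {lam : E → ℝ} {φ : E → ℝ} {Z : E → E} {q : E}
    (hpos : 0 < lam q) (hφ : fderiv ℝ φ q = innerForm E (Z q)) :
    unitNormal (fun q => lam q • innerForm E) φ q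
      = (√(lam q * ‖Z q‖ ^ 2))⁻¹ • Z q := by
  have hg : gradient (fun q => lam q • innerForm E) φ q
      = (lam q)⁻¹ • Z q := by
    rw [gradient, hφ, inverse_smul_innerSL_apply hpos.ne']
  rw [unitNormal, hg, smul_smul]
  congr 1
  have h1 : (lam q • innerForm E) ((lam q)⁻¹ • Z q) ((lam q)⁻¹ • Z q)
      = (lam q * ‖Z q‖ ^ 2) / lam q ^ 2 := by
    simp
    field_simp
  rw [h1, Real.sqrt_div (by positivity), Real.sqrt_sq hpos.le]
  field_simp

/-- The Christoffel term of `λ δ` is `(dλ(v) X + dλ(X) v - ⟨X, v⟩ ∇λ) / (2λ)`. The traces of its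
first and last summands cancel, and the middle one contributes the dimension. -/
theorem trace_covariantDerivative_conformal {lam : E → ℝ} {X : E → E} {p : E}
    {dlam : E →L[ℝ] ℝ} {DX : E →L[ℝ] E} (hlam : HasFDerivAt lam dlam p) (hpos : 0 < lam p)
    (hX : HasFDerivAt X DX p) :
    LinearMap.trace ℝ E
        (covariantDerivative (fun q => lam q • innerForm E) X p)
      = LinearMap.trace ℝ E DX + Module.finrank ℝ E * dlam (X p) / (2 * lam p) := by
  obtain ⟨G, hG⟩ := (InnerProductSpace.toDual ℝ E).surjective dlam
  have hGv : ∀ v, dlam v = inner ℝ G v := by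
    intro v
    rw [← hG]
    simp
  have hg : HasFDerivAt (fun q => lam q • innerForm E)
      (dlam.smulRight (innerForm E)) p := by
    have h : ∀ {F : Type _} [NormedAddCommGroup F] [NormedSpace ℝ F] (c : F),
      HasFDerivAt (fun q => lam q • c) (dlam.smulRight c) p := fun c => hlam.smul_const c
    exact h (F := E →L[ℝ] E →L[ℝ] ℝ) (innerForm E)
  have hchr : ∀ v, christoffelForm (fun q => lam q • innerForm E) p v (X p)
      = innerForm E ((1 / 2 : ℝ) • (dlam v • X p + dlam (X p) • v - inner ℝ (X p) v • G)) := by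
    intro v
    ext z
    simp [christoffelForm, hg.fderiv, hGv]
    rw [real_inner_comm v (X p)]
    ring
  have hcov : covariantDerivative (fun q => lam q • innerForm E) X p
      = (DX : E →ₗ[ℝ] E) + (2 * lam p)⁻¹ • ((dlam : E →ₗ[ℝ] ℝ).smulRight (X p)
        + dlam (X p) • LinearMap.id - (innerForm E (X p) : E →ₗ[ℝ] ℝ).smulRight G) := by
    ext v
    simp only [covariantDerivative, LinearMap.coe_mk, AddHom.coe_mk]
    rw [hchr, inverse_smul_innerSL_apply hpos.ne', hX.fderiv, smul_smul]
    simp [mul_comm]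
  rw [hcov]
  simp only [map_add, map_sub, map_smul, LinearMap.trace_smulRight, LinearMap.trace_id,
    ContinuousLinearMap.coe_coe, innerForm_apply, smul_eq_mul]
  rw [hGv, real_inner_comm]
  field_simp
  ring

/-- The mean curvature of a level set in a conformally flat metric. -/
theorem meanCurvature_conformal {lam φ : E → ℝ} {Z : E → E} {p : E}
    {dlam : E →L[ℝ] ℝ} {DZ : E →L[ℝ] E} (hlam : HasFDerivAt lam dlam p)
    (hpos : ∀ᶠ q in 𝓝 p, 0 < lam q) (hφ : ∀ᶠ q in 𝓝 p, fderiv ℝ φ q = innerForm E (Z q))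
    (hZ : HasFDerivAt Z DZ p) (hZ0 : Z p ≠ 0) :
    meanCurvature (fun q => lam q • innerForm E) φ p
      = (√(lam p * ‖Z p‖ ^ 2))⁻¹ * (LinearMap.trace ℝ E DZ
          - inner ℝ (Z p) (DZ (Z p)) / ‖Z p‖ ^ 2
          + (Module.finrank ℝ E - 1) * dlam (Z p) / (2 * lam p)) := by
  have hp : 0 < lam p := hpos.self_of_nhds
  have hn : 0 < ‖Z p‖ ^ 2 := by positivity
  -- Differentiating the normalising factor along `Z` lowers the coefficient of `dλ(Z)` from the
  -- dimension `N` to `N - 1` and removes the component of `DZ` along `Z` from the trace.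
  have hQ : HasFDerivAt (fun q => lam q * ‖Z q‖ ^ 2)
      (lam p • (2 • (innerForm E (Z p)).comp DZ) + ‖Z p‖ ^ 2 • dlam) p :=
    hlam.mul hZ.norm_sq
  have hm : 0 < lam p * ‖Z p‖ ^ 2 := by positivity
  have hs : HasDerivAt (fun x : ℝ => (√x)⁻¹)
      (-(1 / (2 * √(lam p * ‖Z p‖ ^ 2))) / √(lam p * ‖Z p‖ ^ 2) ^ 2) (lam p * ‖Z p‖ ^ 2) :=
    (Real.hasDerivAt_sqrt hm.ne').inv (by positivity)
  have hh := hs.comp_hasFDerivAt p hQ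
  have hX := hh.smul hZ
  have hX' := hX.congr_of_eventuallyEq (f₁ := unitNormal (fun q => lam q • innerForm E) φ) (by
    filter_upwards [hpos, hφ] with q h1 h2
    rw [unitNormal_conformal h1 h2]
    rfl)
  rw [meanCurvature, trace_covariantDerivative_conformal hlam hp hX',
    unitNormal_conformal hp hφ.self_of_nhds]
  simp only [ContinuousLinearMap.toLinearMap_add,
    ContinuousLinearMap.toLinearMap_smul, map_add, map_smul,
    Function.comp_apply, ContinuousLinearMap.coe_smulRight, LinearMap.trace_smulRight, smul_eq_mul]
  have hsq := Real.sq_sqrt hp.le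
  simp
  field_simp
  rw [hsq]
  ring

/-- The sign of the mean curvature in the metric `U^{4/k} δ` on a space of dimension `k + 2`. -/
theorem meanCurvature_rpow_pos {k : ℝ} (hk : 0 < k) (hrank : (Module.finrank ℝ E : ℝ) = k + 2)
    {U φ : E → ℝ} {Z : E → E} {p : E} {dU : E →L[ℝ] ℝ} {DZ : E →L[ℝ] E}
    (hU : HasFDerivAt U dU p) (hU0 : ∀ q, 0 < U q)
    (hφ : ∀ᶠ q in 𝓝 p, HasFDerivAt φ (innerForm E (Z q)) q)
    (hZ : HasFDerivAt Z DZ p) (hZ0 : Z p ≠ 0) {h : ℝ}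
    (hh : LinearMap.trace ℝ E DZ - inner ℝ (Z p) (DZ (Z p)) / ‖Z p‖ ^ 2 = h)
    (hpos : 0 < k * U p * h + 2 * (k + 1) * dU (Z p)) :
    0 < meanCurvature (fun q => U q ^ (4 / k) • innerForm E) φ p := by
  have hd := (Real.hasDerivAt_rpow_const (p := 4 / k) (Or.inl (hU0 p).ne')).comp_hasFDerivAt p hU
  have hd' : HasFDerivAt (fun q => U q ^ (4 / k)) _ p := hd
  have hUp := hU0 p
  have hdp : ∀ q, 0 < U q ^ (4 / k) := fun q => Real.rpow_pos_of_pos (hU0 q) _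
  rw [meanCurvature_conformal hd' (Eventually.of_forall hdp)
    (hφ.mono fun q hq => hq.fderiv) hZ hZ0, hh]
  have hZp : 0 < ‖Z p‖ := norm_pos_iff.2 hZ0
  have := hdp p
  refine mul_pos (by positivity) ?_
  have hden : U p ^ (4 / k) = U p * U p ^ (4 / k - 1) := by
    rw [Real.rpow_sub_one hUp.ne']
    field_simp
  have hc := Real.rpow_pos_of_pos hUp (4 / k - 1)
  -- With `λ = U^{4/k}`, `dλ / λ = (4/k) dU / U`; the dimension minus one is `k + 1`, so the
  -- conformal term becomes `2 (k + 1) dU(Z) / (k U)`.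
  have heq : h + ((Module.finrank ℝ E : ℝ) - 1)
        * (((4 / k) * U p ^ (4 / k - 1)) • dU) (Z p) / (2 * U p ^ (4 / k))
      = (k * U p * h + 2 * (k + 1) * dU (Z p)) / (k * U p) := by
    rw [hrank, hden]
    simp only [smul_apply, smul_eq_mul]
    field_simp
    ring
  rw [heq]
  positivity

end ConformalGeometry

/-! ### Smooth dependence of integrals on a parameter. -/

section ParametricIntegral

universe u

variable {E H : Type u} [NormedAddCommGroup E] [NormedSpace ℝ E] [ProperSpace E]
  [NormedAddCommGroup H] [NormedSpace ℝ H]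
  {X : Type*} [TopologicalSpace X] [CompactSpace X] [SecondCountableTopology X]
  [MeasurableSpace X] [OpensMeasurableSpace X] {μ : Measure X} [IsFiniteMeasure μ]

/-- Since `E` is proper and `X` compact, the partial derivative is bounded on a closed ball times
`X`; the dominating function can therefore be a constant. -/
theorem hasFDerivAt_integral_of_contDiffOn {F : Type*} [NormedAddCommGroup F] [NormedSpace ℝ F]
    {f : E × H → F} {W : Set (E × H)} {ι : X → H}
    {Ω : Set E} (hW : IsOpen W) (hΩ : IsOpen Ω) (hι : Continuous ι)
    (hsub : ∀ p ∈ Ω, ∀ x, (p, ι x) ∈ W) (hf : ContDiffOn ℝ 1 f W) {p : E} (hp : p ∈ Ω) :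
    HasFDerivAt (fun p => ∫ x, f (p, ι x) ∂μ)
      (∫ x, (fderiv ℝ f (p, ι x)).comp (ContinuousLinearMap.inl ℝ E H) ∂μ) p := by
  obtain ⟨δ, hδ, hball⟩ := Metric.nhds_basis_closedBall.mem_iff.1 (hΩ.mem_nhds hp)
  have hdf : ContinuousOn (fun z : E × H => (fderiv ℝ f z).comp (ContinuousLinearMap.inl ℝ E H)) W :=
    (hf.continuousOn_fderiv_of_isOpen hW le_rfl).clm_comp continuousOn_const
  have hslice : ∀ q ∈ Ω, Continuous fun x => f (q, ι x) := fun q hq =>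
    hf.continuousOn.comp_continuous (by fun_prop) (hsub q hq)
  have hslice' : ∀ q ∈ Ω, Continuous fun x =>
      (fderiv ℝ f (q, ι x)).comp (ContinuousLinearMap.inl ℝ E H) := fun q hq =>
    hdf.comp_continuous (by fun_prop) (hsub q hq)
  have hK : IsCompact (Metric.closedBall p δ ×ˢ (Set.univ : Set X)) :=
    (isCompact_closedBall p δ).prod isCompact_univ
  have hcont : ContinuousOn (fun z : E × X =>
      (fderiv ℝ f (z.1, ι z.2)).comp (ContinuousLinearMap.inl ℝ E H))
      (Metric.closedBall p δ ×ˢ (Set.univ : Set X)) := by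
    refine hdf.comp (f := fun z : E × X => (z.1, ι z.2)) (by fun_prop) ?_
    rintro ⟨q, x⟩ ⟨hq, -⟩
    exact hsub q (hball hq) x
  obtain ⟨C, hC⟩ := hK.exists_bound_of_continuousOn hcont
  refine hasFDerivAt_integral_of_dominated_of_fderiv_le (𝕜 := ℝ) (μ := μ)
    (F := fun p x => f (p, ι x))
    (F' := fun p x => (fderiv ℝ f (p, ι x)).comp (ContinuousLinearMap.inl ℝ E H)) (bound := fun _ => C)
    (Metric.closedBall_mem_nhds p hδ) ?_ ?_ ?_ ?_ (integrable_const C) ?_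
  · filter_upwards [hΩ.mem_nhds hp] with q hq
    exact (hslice q hq).aestronglyMeasurable
  · exact (hslice p hp).integrable_of_hasCompactSupport (HasCompactSupport.of_compactSpace _)
  · exact (hslice' p hp).aestronglyMeasurable
  · exact ae_of_all _ fun x q hq => hC (q, x) ⟨hq, trivial⟩
  · refine ae_of_all _ fun x q hq => ?_
    have h1 : HasFDerivAt f (fderiv ℝ f (q, ι x)) (q, ι x) :=
      ((hf.contDiffAt (hW.mem_nhds (hsub q (hball hq) x))).differentiableAt one_ne_zero).hasFDerivAt
    exact h1.comp q (hasFDerivAt_prodMk_left q (ι x))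

/-- The derivative is an integral of the same kind with values in `E →L[ℝ] F`. The induction
therefore quantifies over `F`, and `E`, `H`, `F` share a universe so that the new target stays in
it. -/
theorem contDiffOn_integral_nat (k : ℕ) : ∀ {F : Type u} [NormedAddCommGroup F] [NormedSpace ℝ F]
    {f : E × H → F} {W : Set (E × H)} {ι : X → H}
    {Ω : Set E} (_ : IsOpen W) (_ : IsOpen Ω) (_ : Continuous ι)
    (_ : ∀ p ∈ Ω, ∀ x, (p, ι x) ∈ W) (_ : ContDiffOn ℝ ∞ f W),
    ContDiffOn ℝ k (fun p => ∫ x, f (p, ι x) ∂μ) Ω := by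
  induction k with
  | zero =>
    intro F _ _ f W ι Ω hW hΩ hι hsub hf
    exact contDiffOn_zero.2 fun p hp => (hasFDerivAt_integral_of_contDiffOn hW hΩ hι hsub
      (hf.of_le (by exact_mod_cast le_top)) hp).continuousAt.continuousWithinAt
  | succ k ih =>
    intro F _ _ f W ι Ω hW hΩ hι hsub hf
    have hd := fun (p : E) (hp : p ∈ Ω) => hasFDerivAt_integral_of_contDiffOn (μ := μ) hW hΩ hι hsub
      (hf.of_le (by exact_mod_cast le_top)) hp
    rw [show ((k + 1 : ℕ) : WithTop ℕ∞) = (k : WithTop ℕ∞) + 1 by norm_cast,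
      contDiffOn_succ_iff_fderiv_of_isOpen hΩ]
    refine ⟨fun p hp => (hd p hp).differentiableAt.differentiableWithinAt, by simp, ?_⟩
    have hdf : ContDiffOn ℝ ∞
        (fun z : E × H => (fderiv ℝ f z).comp (ContinuousLinearMap.inl ℝ E H)) W :=
      (hf.fderiv_of_isOpen hW le_rfl).clm_comp contDiffOn_const
    exact (ih hW hΩ hι hsub hdf).congr fun p hp => (hd p hp).fderiv

theorem contDiffOn_integral {F : Type u} [NormedAddCommGroup F] [NormedSpace ℝ F]
    {f : E × H → F} {W : Set (E × H)} {ι : X → H}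
    {Ω : Set E} (hW : IsOpen W) (hΩ : IsOpen Ω) (hι : Continuous ι)
    (hsub : ∀ p ∈ Ω, ∀ x, (p, ι x) ∈ W) (hf : ContDiffOn ℝ ∞ f W) :
    ContDiffOn ℝ ∞ (fun p => ∫ x, f (p, ι x) ∂μ) Ω :=
  contDiffOn_infty.2 fun k => contDiffOn_integral_nat k hW hΩ hι hsub hf

end ParametricIntegral

/-! ### Riesz kernels and their derivatives. -/

section RieszPotential

universe u

variable {E H : Type u} [NormedAddCommGroup E] [InnerProductSpace ℝ E]

theorem hasFDerivAt_inv_norm_pow (k : ℕ) {v : E} (hv : v ≠ 0) :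
    HasFDerivAt (fun v : E => (‖v‖ ^ k)⁻¹)
      ((-(k : ℝ) * (‖v‖ ^ (k + 2))⁻¹) • innerForm E v) v := by
  have hN : 0 < ‖v‖ := norm_pos_iff.2 hv
  have hsq : HasFDerivAt (fun v : E => ‖v‖ ^ 2) (2 • innerForm E v) v :=
    (hasStrictFDerivAt_norm_sq v).hasFDerivAt
  have hrt := (Real.hasDerivAt_sqrt (pow_pos hN 2).ne').comp_hasFDerivAt v hsq
  have hnorm : HasFDerivAt (fun v : E => ‖v‖) (‖v‖⁻¹ • innerForm E v) v := by
    have h := hrt.congr_of_eventuallyEq (f₁ := fun v : E => ‖v‖)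
      (Eventually.of_forall fun q => by simp)
    refine h.congr_fderiv ?_
    rw [Real.sqrt_sq hN.le, ← Nat.cast_smul_eq_nsmul ℝ, smul_smul]
    congr 1
    push_cast
    field_simp
  have hker := ((hasDerivAt_pow k ‖v‖).inv (by positivity)).comp_hasFDerivAt v hnorm
  refine hker.congr_fderiv ?_
  rw [smul_smul]
  congr 1
  -- The derivative of `x ^ k` carries the truncated exponent `k - 1`, so `k = 0` is separate.
  rcases k with _ | k
  · simp
  · simp only [Nat.add_sub_cancel]
    push_cast
    field_simp
    ring

variable [NormedAddCommGroup H] [NormedSpace ℝ H] (L : H →L[ℝ] E)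

theorem isOpen_offDiagonal : IsOpen {z : E × H | z.1 - L z.2 ≠ 0} :=
  isOpen_ne_fun (by fun_prop) continuous_const

theorem contDiffOn_rieszKernel (k : ℕ) :
    ContDiffOn ℝ ∞ (fun z : E × H => (‖z.1 - L z.2‖ ^ k)⁻¹) {z | z.1 - L z.2 ≠ 0} := by
  intro z hz
  have h : ContDiff ℝ ∞ fun z : E × H => z.1 - L z.2 := by fun_prop
  refine ((h.contDiffAt.norm ℝ hz).pow _).inv ?_ |>.contDiffWithinAt
  exact pow_ne_zero _ (norm_ne_zero_iff.2 hz)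

variable {X : Type*} [TopologicalSpace X] [CompactSpace X] [SecondCountableTopology X]
  [MeasurableSpace X] [OpensMeasurableSpace X] {μ : Measure X} [IsFiniteMeasure μ] [ProperSpace E]

/-- Differentiation of a Riesz potential under the integral sign. -/
theorem fderiv_rieszPotential_apply (k : ℕ) {Ω : Set E} (hΩ : IsOpen Ω) {ι : X → H}
    (hι : Continuous ι) (hsub : ∀ p ∈ Ω, ∀ x, p - L (ι x) ≠ 0) {p : E} (hp : p ∈ Ω) (v : E) :
    fderiv ℝ (fun p => ∫ x, (‖p - L (ι x)‖ ^ k)⁻¹ ∂μ) p v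
      = -(k : ℝ) * ∫ x, (‖p - L (ι x)‖ ^ (k + 2))⁻¹ * inner ℝ (p - L (ι x)) v ∂μ := by
  have h1 := (contDiffOn_rieszKernel L k).of_le (m := 1) (by exact_mod_cast le_top)
  have hd := hasFDerivAt_integral_of_contDiffOn (μ := μ) (isOpen_offDiagonal L) hΩ hι hsub h1 hp
  have hint : Integrable (fun x => (fderiv ℝ (fun z : E × H => (‖z.1 - L z.2‖ ^ k)⁻¹)
      (p, ι x)).comp (ContinuousLinearMap.inl ℝ E H)) μ := by
    refine Continuous.integrable_of_hasCompactSupport ?_ (HasCompactSupport.of_compactSpace _)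
    refine Continuous.clm_comp ?_ continuous_const
    exact (h1.continuousOn_fderiv_of_isOpen (isOpen_offDiagonal L) le_rfl).comp_continuous
      (by fun_prop) (hsub p hp)
  rw [hd.fderiv, ContinuousLinearMap.integral_apply hint, ← integral_const_mul]
  refine integral_congr_ae (ae_of_all _ fun x => ?_)
  have hdiff := (h1.contDiffAt (x := (p, ι x)) ((isOpen_offDiagonal L).mem_nhds (hsub p hp x))).differentiableAt
    one_ne_zero
  have hin : HasFDerivAt (fun e : E => (e, ι x)) (ContinuousLinearMap.inl ℝ E H) p :=
    hasFDerivAt_prodMk_left p (ι x)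
  have hcomp := hdiff.hasFDerivAt.comp p hin
  have hker := (hasFDerivAt_inv_norm_pow k (hsub p hp x)).comp p
    ((hasFDerivAt_id p).sub_const (L (ι x)))
  have heq := congrArg (fun T : E →L[ℝ] ℝ => T v) (hcomp.unique hker)
  simp only at heq ⊢
  rw [heq]
  simp [inner_sub_left]
  ring

end RieszPotential

/-! ### The potential of the removed sphere and the metric. -/

section ConformalFactor

variable {n m : ℕ}

/-- The embedding `x ↦ (x, 0)`. -/
def equatorial (n m : ℕ) : EuclideanSpace ℝ (Fin (n + 1)) →L[ℝ] Space n m :=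
  (WithLp.prodContinuousLinearEquiv 2 ℝ (EuclideanSpace ℝ (Fin (n + 1)))
    (EuclideanSpace ℝ (Fin (m + 1)))).symm.toContinuousLinearMap.comp
      (ContinuousLinearMap.inl ℝ _ _)

@[simp]
theorem equatorial_fst (x : EuclideanSpace ℝ (Fin (n + 1))) : (equatorial n m x).fst = x := rfl

@[simp]
theorem equatorial_snd (x : EuclideanSpace ℝ (Fin (n + 1))) : (equatorial n m x).snd = 0 := rfl

/-- The surface measure of the unit sphere. -/
abbrev surfaceMeasure (n : ℕ) :
    Measure (Metric.sphere (0 : EuclideanSpace ℝ (Fin (n + 1))) 1) :=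
  (volume : Measure (EuclideanSpace ℝ (Fin (n + 1)))).toSphere

/-- The potential of the removed sphere. -/
def potential (n m : ℕ) (p : Space n m) : ℝ :=
  ∫ q : Metric.sphere (0 : EuclideanSpace ℝ (Fin (n + 1))) 1,
    (‖p - equatorial n m q‖ ^ (n + m))⁻¹ ∂surfaceMeasure n

theorem conformalFactor_eq (w ε : ℝ) (p : Space n m) :
    conformalFactor n m w ε p = 1 + ε * (w * potential n m p) := rfl

theorem mem_manifold_iff {p : Space n m} :
    p ∈ manifold n m ↔ ∀ x : EuclideanSpace ℝ (Fin (n + 1)), ‖x‖ = 1 → p - equatorial n m x ≠ 0 := by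
  constructor
  · intro hp x hx h
    rw [sub_eq_zero] at h
    exact hp ⟨by rw [h]; exact hx, by rw [h]; rfl⟩
  · rintro h ⟨h1, h2⟩
    refine h p.fst h1 (sub_eq_zero.2 ?_)
    apply WithLp.ofLp_injective
    exact Prod.ext rfl h2

theorem sub_equatorial_ne_zero {p : Space n m} (hp : p ∈ manifold n m)
    (x : Metric.sphere (0 : EuclideanSpace ℝ (Fin (n + 1))) 1) : p - equatorial n m x ≠ 0 :=
  mem_manifold_iff.1 hp x (by simp)

theorem isOpen_manifold : IsOpen (manifold n m) := by
  have h1 : IsClosed {p : Space n m | ‖p.fst‖ = 1} :=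
    isClosed_eq (by fun_prop) continuous_const
  have h2 : IsClosed {p : Space n m | p.snd = 0} :=
    isClosed_eq (by fun_prop) continuous_const
  exact (h1.inter h2).isOpen_compl

theorem contDiffOn_potential : ContDiffOn ℝ ∞ (potential n m) (manifold n m) :=
  contDiffOn_integral (ι := Subtype.val) (isOpen_offDiagonal (equatorial n m)) isOpen_manifold
    continuous_subtype_val (fun _ hp x => sub_equatorial_ne_zero hp x)
    (contDiffOn_rieszKernel (equatorial n m) (n + m))

theorem fderiv_potential_apply {p : Space n m} (hp : p ∈ manifold n m) (v : Space n m) :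
    fderiv ℝ (potential n m) p v = -((n : ℝ) + m) *
      ∫ q : Metric.sphere (0 : EuclideanSpace ℝ (Fin (n + 1))) 1,
        (‖p - equatorial n m q‖ ^ (n + m + 2))⁻¹ * inner ℝ (p - equatorial n m q) v
          ∂surfaceMeasure n := by
  have h := fderiv_rieszPotential_apply (μ := surfaceMeasure n) (equatorial n m) (n + m)
    isOpen_manifold (ι := Subtype.val) continuous_subtype_val
    (fun _ hp x => sub_equatorial_ne_zero hp x) hp v
  rw [← Nat.cast_add]
  exact h

theorem potential_nonneg (p : Space n m) : 0 ≤ potential n m p :=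
  integral_nonneg fun _ => by positivity

/-- The bound holds at every point, removed sphere included, so positivity of `U` never requires
restricting to `M`. -/
theorem one_le_conformalFactor {w ε : ℝ} (hw : 0 < w) (hε : 0 < ε) (p : Space n m) :
    1 ≤ conformalFactor n m w ε p := by
  have := potential_nonneg p
  rw [conformalFactor_eq]
  have : 0 ≤ ε * (w * potential n m p) := by positivity
  linarith

theorem contDiffOn_conformalFactor (w ε : ℝ) :
    ContDiffOn ℝ ∞ (conformalFactor n m w ε) (manifold n m) :=
  contDiffOn_const.add (contDiffOn_const.mul (contDiffOn_const.mul contDiffOn_potential))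

/-- The conformal density `U^{4/(n+m)}` of the metric. -/
def density (n m : ℕ) (w ε : ℝ) (p : Space n m) : ℝ :=
  conformalFactor n m w ε p ^ (4 / ((n : ℝ) + m))

theorem metric_eq (w ε : ℝ) :
    metric n m w ε = fun p => density n m w ε p • innerForm (Space n m) := rfl

theorem density_pos {w ε : ℝ} (hw : 0 < w) (hε : 0 < ε) (p : Space n m) :
    0 < density n m w ε p :=
  Real.rpow_pos_of_pos (zero_lt_one.trans_le (one_le_conformalFactor hw hε p)) _

theorem contDiffOn_density {w ε : ℝ} (hw : 0 < w) (hε : 0 < ε) :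
    ContDiffOn ℝ ∞ (density n m w ε) (manifold n m) :=
  (contDiffOn_conformalFactor w ε).rpow_const_of_ne fun p _ =>
    (zero_lt_one.trans_le (one_le_conformalFactor hw hε p)).ne'

theorem isRiemannianMetricOn_metric {w ε : ℝ} (hw : 0 < w) (hε : 0 < ε) :
    IsRiemannianMetricOn (metric n m w ε) (manifold n m) where
  isOpen := isOpen_manifold
  smooth := by
    rw [metric_eq]
    have h : ∀ {F : Type} [NormedAddCommGroup F] [NormedSpace ℝ F] (c : F),
        ContDiffOn ℝ ∞ (fun p => density n m w ε p • c) (manifold n m) :=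
      fun c => (contDiffOn_density hw hε).smul contDiffOn_const
    exact h (F := Space n m →L[ℝ] Space n m →L[ℝ] ℝ) _
  symm p _ v w' := by
    rw [metric_eq]
    simp [real_inner_comm]
  pos p _ v hv := by
    rw [metric_eq]
    have := density_pos hw hε p
    have : 0 < ‖v‖ := norm_pos_iff.2 hv
    simp only [smul_apply, smul_apply, innerForm_apply, real_inner_self_eq_norm_sq,
      smul_eq_mul]
    positivity

theorem finrank_space : (Module.finrank ℝ (Space n m) : ℝ) = n + m + 2 := by
  have h : Module.finrank ℝ (Space n m) = n + m + 2 := by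
    rw [(WithLp.linearEquiv 2 ℝ _).finrank_eq]
    simp
    ring
  rw [h]
  push_cast
  ring

/-- Reduction of the sign of the mean curvature to the derivative of the potential. -/
theorem meanCurvature_metric_pos {w ε : ℝ} (hw : 0 < w) (hε : 0 < ε) (hn : 1 ≤ n)
    {p : Space n m} (hp : p ∈ manifold n m) {φ : Space n m → ℝ} {Z : Space n m → Space n m}
    {DZ : Space n m →L[ℝ] Space n m}
    (hφ : ∀ᶠ q in 𝓝 p, HasFDerivAt φ (innerForm (Space n m) (Z q)) q)
    (hZ : HasFDerivAt Z DZ p) (hZ0 : Z p ≠ 0) {h : ℝ}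
    (hh : LinearMap.trace ℝ (Space n m) DZ - inner ℝ (Z p) (DZ (Z p)) / ‖Z p‖ ^ 2 = h)
    (hpos : 0 < ((n : ℝ) + m) * (1 + ε * (w * potential n m p)) * h
      + 2 * (n + m + 1) * (ε * (w * fderiv ℝ (potential n m) p (Z p)))) :
    0 < meanCurvature (metric n m w ε) φ p := by
  have hn' : (1 : ℝ) ≤ n := by exact_mod_cast hn
  have hpot : HasFDerivAt (potential n m) (fderiv ℝ (potential n m) p) p :=
    ((contDiffOn_potential.contDiffAt (isOpen_manifold.mem_nhds hp)).differentiableAt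
      (by simp)).hasFDerivAt
  have hUd : HasFDerivAt (conformalFactor n m w ε)
      (ε • (w • fderiv ℝ (potential n m) p)) p :=
    ((hpot.const_mul w).const_mul ε).const_add 1
  exact meanCurvature_rpow_pos (k := (n : ℝ) + m) (by positivity) finrank_space hUd
    (fun q => zero_lt_one.trans_le (one_le_conformalFactor hw hε q)) hφ hZ hZ0 hh hpos

end ConformalFactor

/-! ### Sphere integrals as ball integrals. -/

section SphereIntegral

variable {E : Type*} [NormedAddCommGroup E] [NormedSpace ℝ E] [FiniteDimensional ℝ E]
  [MeasurableSpace E] [BorelSpace E] [Nontrivial E]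

/-- Integrals over the unit sphere as integrals over the unit ball. -/
theorem integral_toSphere_eq (μ : Measure E) [μ.IsAddHaarMeasure] (f : E → ℝ) :
    ∫ q, f q ∂μ.toSphere
      = Module.finrank ℝ E * ∫ z in Metric.ball (0 : E) 1, f (‖z‖⁻¹ • z) ∂μ := by
  have hpos : 0 < Module.finrank ℝ E := Module.finrank_pos
  set d := Module.finrank ℝ E with hd
  have h1 : ∫ z in Metric.ball (0 : E) 1, f (‖z‖⁻¹ • z) ∂μ
      = ∫ z : ({0}ᶜ : Set E), (Metric.ball (0 : E) 1).indicator (fun z => f (‖z‖⁻¹ • z)) z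
          ∂(μ.comap (↑)) := by
    rw [integral_subtype_comap (measurableSet_singleton (0 : E)).compl
        ((Metric.ball (0 : E) 1).indicator fun z => f (‖z‖⁻¹ • z)),
      ← integral_indicator Metric.isOpen_ball.measurableSet]
    refine (setIntegral_eq_integral_of_ae_compl_eq_zero ?_).symm
    have : ∀ᵐ z ∂μ, z ≠ 0 := by simp [ae_iff]
    filter_upwards [this] with z hz hz'
    exact absurd hz hz'
  -- In polar coordinates the unit ball is the condition `radius < 1`, and the radial factor is `∫₀¹
  -- ρ^(d-1) dρ = 1/d`.
  have h2 := (μ.measurePreserving_homeomorphUnitSphereProd).integral_comp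
    (Homeomorph.measurableEmbedding _)
    (fun z : Metric.sphere (0 : E) 1 × Set.Ioi (0 : ℝ) =>
      f z.1 * (Set.Iio (⟨1, Set.mem_Ioi.2 one_pos⟩ : Set.Ioi (0 : ℝ))).indicator (1 : Set.Ioi (0 : ℝ) → ℝ) z.2)
  rw [integral_prod_mul (μ := μ.toSphere) (fun q : Metric.sphere (0 : E) 1 => f q),
    integral_indicator_one measurableSet_Iio, measureReal_def,
    Measure.volumeIoiPow_apply_Iio] at h2
  rw [h1]
  have h3 : ∫ z : ({0}ᶜ : Set E), (Metric.ball (0 : E) 1).indicator (fun z => f (‖z‖⁻¹ • z)) z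
          ∂(μ.comap (↑)) = (∫ q, f q ∂μ.toSphere) * (d : ℝ)⁻¹ := by
    rw [show (d : ℝ)⁻¹ = (ENNReal.ofReal ((1 : ℝ) ^ (d - 1 + 1) / ((d - 1 : ℕ) + 1))).toReal by
      rw [ENNReal.toReal_ofReal (by positivity), one_pow, ← Nat.cast_add_one,
        Nat.sub_add_cancel hpos, one_div], ← h2]
    refine integral_congr_ae (ae_of_all _ fun z => ?_)
    by_cases hz : ‖(z : E)‖ < 1
    · simp [Set.indicator, homeomorphUnitSphereProd, ← Subtype.coe_lt_coe, hz]
    · simp [Set.indicator, homeomorphUnitSphereProd, ← Subtype.coe_lt_coe, hz]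
  rw [h3]
  have : (d : ℝ) ≠ 0 := by positivity
  field_simp

end SphereIntegral

/-! ### Rotations and zonal functions on the sphere. -/

section Rotation

variable {n : ℕ} {V W : Type*} [NormedAddCommGroup V]
  [InnerProductSpace ℝ V] [FiniteDimensional ℝ V] [NormedAddCommGroup W]
  [InnerProductSpace ℝ W] [FiniteDimensional ℝ W]

theorem exists_orthonormalBasis_zero_eq (hV : Module.finrank ℝ V = n + 1) {v : V} (hv : ‖v‖ = 1) :
    ∃ b : OrthonormalBasis (Fin (n + 1)) ℝ V, b 0 = v := by
  have horth : Orthonormal ℝ (({0} : Set (Fin (n + 1))).domRestrict fun _ => v) :=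
    ⟨fun _ => hv, fun i j hij => absurd (Subsingleton.elim i j) hij⟩
  obtain ⟨b, hb⟩ := horth.exists_orthonormalBasis_extension_of_card_eq (by simp [hV])
  exact ⟨b, hb 0 rfl⟩

theorem exists_linearIsometryEquiv_map_eq (hV : Module.finrank ℝ V = n + 1)
    (hW : Module.finrank ℝ W = n + 1) {v : V} {u : W} (hv : ‖v‖ = 1) (hu : ‖u‖ = 1) :
    ∃ T : V ≃ₗᵢ[ℝ] W, T v = u := by
  obtain ⟨b, hb⟩ := exists_orthonormalBasis_zero_eq hV hv
  obtain ⟨c, hc⟩ := exists_orthonormalBasis_zero_eq hW hu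
  exact ⟨b.equiv c (Equiv.refl _), by rw [← hb, OrthonormalBasis.equiv_apply_basis]; simpa⟩

/-- Zonal integrals over the unit sphere of `ℝ^(n+1)`. -/
theorem integral_sphere_zonal {n : ℕ} {e : EuclideanSpace ℝ (Fin (n + 1))} (he : ‖e‖ = 1)
    (h : ℝ → ℝ) :
    ∫ q, h (inner ℝ e (q : EuclideanSpace ℝ (Fin (n + 1)))) ∂surfaceMeasure n
      = (n + 1) * ∫ y : ℝ × EuclideanSpace ℝ (Fin n),
          {y : ℝ × EuclideanSpace ℝ (Fin n) | y.1 ^ 2 + ‖y.2‖ ^ 2 < 1}.indicator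
            (fun y => h (y.1 / √(y.1 ^ 2 + ‖y.2‖ ^ 2))) y := by
  rw [integral_toSphere_eq volume fun q => h (inner ℝ e q)]
  rw [finrank_euclideanSpace_fin, Nat.cast_add_one]
  congr 1
  have hu : ‖(WithLp.toLp 2 ((1 : ℝ), (0 : EuclideanSpace ℝ (Fin n))) :
      WithLp 2 (ℝ × EuclideanSpace ℝ (Fin n)))‖ = 1 := by
    rw [WithLp.prod_norm_eq_of_L2]
    simp
  have hW : Module.finrank ℝ (WithLp 2 (ℝ × EuclideanSpace ℝ (Fin n))) = n + 1 := by
    rw [(WithLp.linearEquiv 2 ℝ _).finrank_eq]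
    simp
    ring
  -- An isometry from `ℝ × ℝ^n` sending `(1, 0)` to `e` turns the inner product with `e` into the
  -- first coordinate.
  obtain ⟨T, hT⟩ := exists_linearIsometryEquiv_map_eq (n := n) hW (by simp) hu he
  have hmp := T.measurePreserving.comp
    (WithLp.volume_preserving_toLp ℝ (EuclideanSpace ℝ (Fin n)))
  have hemb : MeasurableEmbedding (⇑T ∘ WithLp.toLp 2 :
      ℝ × EuclideanSpace ℝ (Fin n) → EuclideanSpace ℝ (Fin (n + 1))) :=
    T.toHomeomorph.measurableEmbedding.comp
      (WithLp.homeomorphProd 2 ℝ (EuclideanSpace ℝ (Fin n))).symm.measurableEmbedding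
  rw [← integral_indicator Metric.isOpen_ball.measurableSet, ← hmp.integral_comp hemb]
  refine integral_congr_ae (ae_of_all _ fun y => ?_)
  have hnorm : ‖T (WithLp.toLp 2 y)‖ = √(y.1 ^ 2 + ‖y.2‖ ^ 2) := by
    rw [T.norm_map, WithLp.prod_norm_eq_of_L2]
    simp
  have hinner : inner ℝ e (T (WithLp.toLp 2 y)) = y.1 := by
    rw [← hT, T.inner_map_map, WithLp.prod_inner_apply]
    simp
  have hiff : √(y.1 ^ 2 + ‖y.2‖ ^ 2) < 1 ↔ y.1 ^ 2 + ‖y.2‖ ^ 2 < 1 := by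
    rw [Real.sqrt_lt' one_pos, one_pow]
  simp only [Set.indicator, Function.comp_apply, Metric.mem_ball, dist_zero_right, hnorm, hiff,
    Set.mem_ofPred_eq, real_inner_smul_right, hinner]
  rw [inv_mul_eq_div]

end Rotation

/-! ### Blow-up limit of the sphere integral. -/

section Profile

/-- The Bessel-type integral `∫_{ℝ^n} (1 + |z|²)^{-α} dz`. -/
def japaneseIntegral (n : ℕ) (α : ℝ) : ℝ :=
  ∫ z : EuclideanSpace ℝ (Fin n), (1 + ‖z‖ ^ 2) ^ (-α)

variable {n : ℕ} {α : ℝ}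

theorem integrable_japanese (hα : (n : ℝ) / 2 < α) :
    Integrable fun z : EuclideanSpace ℝ (Fin n) => (1 + ‖z‖ ^ 2) ^ (-α) := by
  have h := integrable_rpow_neg_one_add_norm_sq (E := EuclideanSpace ℝ (Fin n)) (μ := volume)
    (r := 2 * α) (by simp; linarith)
  refine h.congr (ae_of_all _ fun z => ?_)
  simp only
  congr 1
  ring

theorem japaneseIntegral_pos (hα : (n : ℝ) / 2 < α) : 0 < japaneseIntegral n α := by
  have hpos : ∀ z : EuclideanSpace ℝ (Fin n), 0 < (1 + ‖z‖ ^ 2) ^ (-α) :=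
    fun z => Real.rpow_pos_of_pos (by positivity) _
  rw [japaneseIntegral, integral_pos_iff_support_of_nonneg (fun z => (hpos z).le)
    (integrable_japanese hα)]
  have : Function.support (fun z : EuclideanSpace ℝ (Fin n) => (1 + ‖z‖ ^ 2) ^ (-α)) = Set.univ :=
    Set.eq_univ_of_forall fun z => (hpos z).ne'
  rw [this]
  exact isOpen_univ.measure_pos _ Set.univ_nonempty

/-- Substitute `z ↦ √t z`. The exact power law in `t` is what gets differentiated in
`japaneseIntegral_add_one`. -/
theorem integral_rpow_add_norm_sq {t : ℝ} (ht : 0 < t) :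
    ∫ z : EuclideanSpace ℝ (Fin n), (t + ‖z‖ ^ 2) ^ (-α)
      = t ^ ((n : ℝ) / 2 - α) * japaneseIntegral n α := by
  have h := Measure.integral_comp_smul (volume : Measure (EuclideanSpace ℝ (Fin n)))
    (fun z => (t + ‖z‖ ^ 2) ^ (-α)) (√t)
  have h1 : (fun z : EuclideanSpace ℝ (Fin n) => (t + ‖√t • z‖ ^ 2) ^ (-α))
      = fun z => t ^ (-α) * (1 + ‖z‖ ^ 2) ^ (-α) := by
    ext z
    rw [← Real.mul_rpow ht.le (by positivity), norm_smul, mul_pow, Real.norm_eq_abs, sq_abs,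
      Real.sq_sqrt ht.le]
    ring_nf
  have hs : 0 < √t := Real.sqrt_pos.2 ht
  have h2 : √t ^ n = t ^ ((n : ℝ) / 2) := by
    rw [Real.sqrt_eq_rpow, ← Real.rpow_mul_natCast ht.le]
    congr 1
    ring
  rw [h1, integral_const_mul, finrank_euclideanSpace_fin, abs_of_pos (by positivity), smul_eq_mul,
    ← japaneseIntegral, h2, eq_inv_mul_iff_mul_eq₀ (by positivity), ← mul_assoc,
    ← Real.rpow_add ht] at h
  rw [← h, sub_eq_add_neg]

/-- Differentiate `t ↦ ∫ (t + |z|²)^{-α}` at `t = 1` twice over: under the integral sign, and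
through the scaling law. For `α = (n + m)/2` the ratio of the two integrals is `m / (n + m)`. -/
theorem japaneseIntegral_add_one (hα : (n : ℝ) / 2 < α) :
    α * japaneseIntegral n (α + 1) = (α - n / 2) * japaneseIntegral n α := by
  have hα0 : 0 < α := lt_of_le_of_lt (by positivity) hα
  have hcont : ∀ (β t : ℝ), 0 < t →
      Continuous fun z : EuclideanSpace ℝ (Fin n) => (t + ‖z‖ ^ 2) ^ β := fun β t ht =>
    Continuous.rpow_const (by fun_prop) fun z => Or.inl (by positivity)
  have hd := (hasDerivAt_integral_of_dominated_loc_of_deriv_le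
    (μ := (volume : Measure (EuclideanSpace ℝ (Fin n))))
    (F := fun t z => (t + ‖z‖ ^ 2) ^ (-α)) (F' := fun t z => -α * (t + ‖z‖ ^ 2) ^ (-α - 1))
    (x₀ := (1 : ℝ)) (s := Metric.ball 1 (1 / 2))
    -- For `t > 1/2` one has `t + |z|² ≥ (1 + |z|²)/2`, and the exponent `-α - 1` is negative.
    (bound := fun z => α * ((1 / 2) ^ (-α - 1) * (1 + ‖z‖ ^ 2) ^ (-(α + 1))))
    (Metric.ball_mem_nhds _ (by norm_num)) ?_ (integrable_japanese hα) ?_ ?_ ?_ ?_).2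
  · have heq : HasDerivAt (fun t => ∫ z : EuclideanSpace ℝ (Fin n), (t + ‖z‖ ^ 2) ^ (-α))
        ((((n : ℝ) / 2 - α) * 1 ^ ((n : ℝ) / 2 - α - 1)) * japaneseIntegral n α) 1 := by
      refine ((Real.hasDerivAt_rpow_const (Or.inl one_ne_zero)).mul_const _).congr_of_eventuallyEq ?_
      filter_upwards [lt_mem_nhds one_pos] with t ht
      exact integral_rpow_add_norm_sq ht
    have h := hd.unique heq
    rw [integral_const_mul, Real.one_rpow, mul_one, ← neg_add', ← japaneseIntegral] at h
    linarith
  · filter_upwards [lt_mem_nhds one_pos] with t ht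
    exact (hcont _ t ht).aestronglyMeasurable
  · exact ((hcont _ 1 one_pos).const_mul _).aestronglyMeasurable
  · refine ae_of_all _ fun z t ht => ?_
    rw [Metric.mem_ball, Real.dist_eq, abs_lt] at ht
    have ht0 : 1 / 2 < t := by linarith
    have hb : 0 < t + ‖z‖ ^ 2 := by positivity
    rw [norm_mul, norm_neg, Real.norm_of_nonneg hα0.le,
      Real.norm_of_nonneg (Real.rpow_pos_of_pos hb _).le]
    refine mul_le_mul_of_nonneg_left ?_ hα0.le
    rw [neg_add', ← Real.mul_rpow (by norm_num) (by positivity)]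
    refine Real.rpow_le_rpow_of_nonpos (by positivity) ?_ (by linarith)
    nlinarith [sq_nonneg ‖z‖]
  · exact ((integrable_japanese (by linarith)).const_mul _).const_mul _
  · refine ae_of_all _ fun z t ht => ?_
    rw [Metric.mem_ball, Real.dist_eq, abs_lt] at ht
    have ht0 : 1 / 2 < t := by linarith
    have hb : t + ‖z‖ ^ 2 ≠ 0 := by positivity
    have h := ((hasDerivAt_id t).add_const (‖z‖ ^ 2)).rpow_const (p := -α) (Or.inl hb)
    simpa using h

/-- Only the directions transverse to `e` are dilated: near `e` the sphere looks like `ℝ^n` at scale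
`τ`, while the radial coordinate of the ball keeps its size. -/
theorem integral_prod_smul_right {τ : ℝ} (hτ : 0 < τ)
    (f : ℝ × EuclideanSpace ℝ (Fin n) → ℝ) :
    ∫ y, f y = τ ^ n * ∫ y : ℝ × EuclideanSpace ℝ (Fin n), f (y.1, τ • y.2) := by
  let T : ℝ × EuclideanSpace ℝ (Fin n) ≃ₜ ℝ × EuclideanSpace ℝ (Fin n) :=
    (Homeomorph.refl ℝ).prodCongr (Homeomorph.smulOfNeZero τ hτ.ne')
  have hmap : Measure.map T volume = ENNReal.ofReal ((τ ^ n)⁻¹) •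
      (volume : Measure (ℝ × EuclideanSpace ℝ (Fin n))) := by
    have h := Measure.map_prod_map (volume : Measure ℝ)
      (volume : Measure (EuclideanSpace ℝ (Fin n))) measurable_id (measurable_const_smul τ)
    rw [Measure.map_id, Measure.map_addHaar_smul _ hτ.ne', Measure.prod_smul_right,
      finrank_euclideanSpace_fin, abs_of_pos (by positivity)] at h
    exact h.symm
  have h := T.measurableEmbedding.integral_map (μ := volume) f
  rw [hmap, integral_smul_measure, ENNReal.toReal_ofReal (by positivity), smul_eq_mul,
    inv_mul_eq_iff_eq_mul₀ (by positivity)] at h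
  exact h

variable (n α) in
/-- The integrand of the zonal integral over the sphere after rescaling by `τ`. -/
def profileIntegrand (τ : ℝ) : ℝ × EuclideanSpace ℝ (Fin n) → ℝ :=
  {y : ℝ × EuclideanSpace ℝ (Fin n) | y.1 ^ 2 + τ ^ 2 * ‖y.2‖ ^ 2 < 1}.indicator
    fun y => (1 + (2 - 2 * (y.1 / √(y.1 ^ 2 + τ ^ 2 * ‖y.2‖ ^ 2))) / τ ^ 2) ^ (-α)

variable (n α) in
/-- The rescaled integral `τ^{-n} ∫_{S^n} (1 + |e - q|² / τ²)^{-α} dσ(q)`. -/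
def profile (τ : ℝ) : ℝ := (n + 1) * ∫ y, profileIntegrand n α τ y

theorem integral_sphere_eq_profile {e : EuclideanSpace ℝ (Fin (n + 1))} (he : ‖e‖ = 1) {τ : ℝ}
    (hτ : 0 < τ) :
    ∫ q, (1 + ‖e - (q : EuclideanSpace ℝ (Fin (n + 1)))‖ ^ 2 / τ ^ 2) ^ (-α) ∂surfaceMeasure n
      = τ ^ n * profile n α τ := by
  have h := integral_sphere_zonal he fun t => (1 + (2 - 2 * t) / τ ^ 2) ^ (-α)
  rw [integral_prod_smul_right hτ] at h
  have h1 : ∀ q : Metric.sphere (0 : EuclideanSpace ℝ (Fin (n + 1))) 1,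
      ‖e - (q : EuclideanSpace ℝ (Fin (n + 1)))‖ ^ 2
        = 2 - 2 * inner ℝ e (q : EuclideanSpace ℝ (Fin (n + 1))) := by
    intro q
    rw [norm_sub_sq_real, he, norm_eq_of_mem_sphere q]
    ring
  simp_rw [h1]
  rw [h, profile, ← mul_assoc, ← mul_assoc, mul_comm (τ ^ n)]
  congr 1
  refine integral_congr_ae (ae_of_all _ fun y => ?_)
  simp [profileIntegrand, Set.indicator, norm_smul, mul_pow]

/-- With `l` the norm of the rescaled point and `c = y₁ / l`, one has `2 - 2c ≥ 1 - c² = τ² |y₂|² /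
l² ≥ τ² |y₂|²`, because `l < 1`. The bound is integrable and free of `τ`; excluding `y₁ = 0` keeps
`l` positive and costs a null set. -/
theorem norm_profileIntegrand_le (hα : 0 < α) {τ : ℝ} (hτ : 0 < τ)
    {y : ℝ × EuclideanSpace ℝ (Fin n)} (hy : y.1 ≠ 0) :
    ‖profileIntegrand n α τ y‖
      ≤ (Set.Icc (-1 : ℝ) 1).indicator 1 y.1 * (1 + ‖y.2‖ ^ 2) ^ (-α) := by
  rw [profileIntegrand, Set.indicator]
  split_ifs with h
  · simp only [Set.mem_ofPred_eq] at h
    have hnn : 0 ≤ τ ^ 2 * ‖y.2‖ ^ 2 := by positivity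
    have hy2 : 0 < y.1 ^ 2 := by positivity
    have hmem : y.1 ∈ Set.Icc (-1 : ℝ) 1 := by
      rw [Set.mem_Icc, ← abs_le, ← sq_le_one_iff_abs_le_one]
      linarith
    rw [Set.indicator_of_mem hmem, Pi.one_apply, one_mul]
    set l := √(y.1 ^ 2 + τ ^ 2 * ‖y.2‖ ^ 2) with hl
    have hl2 : l ^ 2 = y.1 ^ 2 + τ ^ 2 * ‖y.2‖ ^ 2 := Real.sq_sqrt (by positivity)
    have hl0 : 0 < l := Real.sqrt_pos.2 (by positivity)
    have h1 : τ ^ 2 * ‖y.2‖ ^ 2 ≤ 2 - 2 * (y.1 / l) := by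
      have h2 : 1 - (y.1 / l) ^ 2 = τ ^ 2 * ‖y.2‖ ^ 2 / l ^ 2 := by
        field_simp
        linarith
      have h3 : τ ^ 2 * ‖y.2‖ ^ 2 ≤ τ ^ 2 * ‖y.2‖ ^ 2 / l ^ 2 := by
        rw [le_div_iff₀ (by positivity)]
        nlinarith
      nlinarith [sq_nonneg (1 - y.1 / l)]
    have h4 : 1 + ‖y.2‖ ^ 2 ≤ 1 + (2 - 2 * (y.1 / l)) / τ ^ 2 := by
      gcongr
      rw [le_div_iff₀ (by positivity)]
      linarith
    have h5 : 0 < 1 + ‖y.2‖ ^ 2 := by positivity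
    rw [Real.norm_of_nonneg (Real.rpow_nonneg (h5.le.trans h4) _)]
    exact Real.rpow_le_rpow_of_nonpos h5 h4 (by linarith)
  · rw [norm_zero]
    have : 0 ≤ (Set.Icc (-1 : ℝ) 1).indicator (1 : ℝ → ℝ) y.1 :=
      Set.indicator_nonneg (fun _ _ => zero_le_one) _
    positivity

/-- For `a < 0` the point lies in the hemisphere opposite to `e`, and the base is at least `2/τ²`,
so the limit is zero. For `0 < a < 1` rationalising gives `2 - 2a/l = 2 τ² |v|² / (l (l + a))` with
`l → a`. For `a > 1` the point is outside the ball. -/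
theorem tendsto_profileIntegrand (hα : 0 < α) {y : ℝ × EuclideanSpace ℝ (Fin n)} (h0 : y.1 ≠ 0)
    (h1 : y.1 ≠ 1) (h2 : y.1 ≠ -1) :
    Tendsto (fun τ => profileIntegrand n α τ y) (𝓝[>] 0)
      (𝓝 ((Set.Ioo (0 : ℝ) 1).indicator (fun a => (1 + (a⁻¹ ^ 2 * ‖y.2‖ ^ 2)) ^ (-α)) y.1)) := by
  obtain ⟨a, v⟩ := y
  simp only at h0 h1 h2 ⊢
  have hl : Tendsto (fun τ : ℝ => a ^ 2 + τ ^ 2 * ‖v‖ ^ 2) (𝓝[>] 0) (𝓝 (a ^ 2)) := by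
    have : Continuous fun τ : ℝ => a ^ 2 + τ ^ 2 * ‖v‖ ^ 2 := by fun_prop
    simpa using (this.tendsto 0).mono_left nhdsWithin_le_nhds
  rcases lt_or_gt_of_ne h0 with ha | ha
  · rw [Set.indicator_of_notMem (fun h => lt_asymm ha h.1)]
    have hlim : Tendsto (fun τ : ℝ => (2 * (τ ^ 2)⁻¹) ^ (-α)) (𝓝[>] 0) (𝓝 0) := by
      refine (tendsto_rpow_neg_atTop hα).comp (Tendsto.const_mul_atTop two_pos ?_)
      refine tendsto_inv_nhdsGT_zero.comp (tendsto_nhdsWithin_iff.2 ⟨?_, ?_⟩)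
      · have : Continuous fun τ : ℝ => τ ^ 2 := by fun_prop
        simpa using (this.tendsto 0).mono_left nhdsWithin_le_nhds
      · filter_upwards [self_mem_nhdsWithin] with τ hτ
        exact pow_pos (Set.mem_Ioi.1 hτ) 2
    refine squeeze_zero_norm' ?_ hlim
    filter_upwards [self_mem_nhdsWithin] with τ hτ
    have hτ' : 0 < τ := hτ
    rw [profileIntegrand, Set.indicator]
    split_ifs
    · have hle : 2 * (τ ^ 2)⁻¹ ≤ 1 + (2 - 2 * (a / √(a ^ 2 + τ ^ 2 * ‖v‖ ^ 2))) / τ ^ 2 := by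
        have : a / √(a ^ 2 + τ ^ 2 * ‖v‖ ^ 2) ≤ 0 :=
          div_nonpos_of_nonpos_of_nonneg ha.le (Real.sqrt_nonneg _)
        have h3 : 2 / τ ^ 2 ≤ (2 - 2 * (a / √(a ^ 2 + τ ^ 2 * ‖v‖ ^ 2))) / τ ^ 2 := by
          gcongr
          linarith
        rw [← div_eq_mul_inv]
        linarith
      have hp : 0 < 2 * (τ ^ 2)⁻¹ := by positivity
      rw [Real.norm_of_nonneg (Real.rpow_nonneg (hp.le.trans hle) _)]
      exact Real.rpow_le_rpow_of_nonpos hp hle (by linarith)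
    · rw [norm_zero]
      positivity
  · rcases lt_or_gt_of_ne h1 with hb | hb
    · rw [Set.indicator_of_mem (show a ∈ Set.Ioo (0 : ℝ) 1 from ⟨ha, hb⟩)]
      have hev : ∀ᶠ τ : ℝ in 𝓝[>] 0, a ^ 2 + τ ^ 2 * ‖v‖ ^ 2 < 1 :=
        hl.eventually_lt_const (by nlinarith)
      have hsq : Tendsto (fun τ : ℝ => √(a ^ 2 + τ ^ 2 * ‖v‖ ^ 2)) (𝓝[>] 0) (𝓝 a) := by
        have := (Real.continuous_sqrt.tendsto (a ^ 2)).comp hl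
        rwa [Real.sqrt_sq ha.le] at this
      have hlim : Tendsto (fun τ : ℝ => (1 + 2 * ‖v‖ ^ 2 / (√(a ^ 2 + τ ^ 2 * ‖v‖ ^ 2)
          * (√(a ^ 2 + τ ^ 2 * ‖v‖ ^ 2) + a))) ^ (-α)) (𝓝[>] 0)
          (𝓝 ((1 + 2 * ‖v‖ ^ 2 / (a * (a + a))) ^ (-α))) := by
        refine ((tendsto_const_nhds.div (hsq.mul (hsq.add_const a)) (by positivity)).const_add
          1).rpow_const (Or.inl (by positivity))
      have hval : 1 + 2 * ‖v‖ ^ 2 / (a * (a + a)) = 1 + a⁻¹ ^ 2 * ‖v‖ ^ 2 := by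
        field_simp
        ring
      rw [← hval]
      refine hlim.congr' ?_
      filter_upwards [hev, self_mem_nhdsWithin] with τ hτ hτ0
      have hτ' : 0 < τ := hτ0
      rw [profileIntegrand, Set.indicator_of_mem (show (a, v) ∈ {y : ℝ × EuclideanSpace ℝ (Fin n) |
        y.1 ^ 2 + τ ^ 2 * ‖y.2‖ ^ 2 < 1} from hτ)]
      simp only
      set l := √(a ^ 2 + τ ^ 2 * ‖v‖ ^ 2) with hl'
      have hl2 : l ^ 2 = a ^ 2 + τ ^ 2 * ‖v‖ ^ 2 := Real.sq_sqrt (by positivity)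
      have hl0 : 0 < l := Real.sqrt_pos.2 (by positivity)
      congr 2
      field_simp
      linarith
    · rw [Set.indicator_of_notMem (fun h => lt_asymm hb h.2)]
      refine tendsto_const_nhds.congr fun τ => ?_
      rw [profileIntegrand, Set.indicator_of_notMem]
      simp only [Set.mem_ofPred_eq, not_lt]
      nlinarith [mul_nonneg (sq_nonneg τ) (sq_nonneg ‖v‖)]

/-- Dominated convergence. In the limit, the slice at height `a` integrates to `a^n` times the
integral over `ℝ^n`, and `∫₀¹ a^n da = 1/(n + 1)` cancels the factor `n + 1` in `profile`. -/
theorem tendsto_profile (hα : (n : ℝ) / 2 < α) :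
    Tendsto (profile n α) (𝓝[>] 0) (𝓝 (japaneseIntegral n α)) := by
  have hα0 : 0 < α := lt_of_le_of_lt (by positivity) hα
  have hne : ∀ c : ℝ, ∀ᵐ y : ℝ × EuclideanSpace ℝ (Fin n), y.1 ≠ c := fun c =>
    Measure.quasiMeasurePreserving_fst.ae (p := fun a : ℝ => a ≠ c) (by simp [ae_iff])
  have hbound : Integrable (fun y : ℝ × EuclideanSpace ℝ (Fin n) =>
      (Set.Icc (-1 : ℝ) 1).indicator (1 : ℝ → ℝ) y.1 * (1 + ‖y.2‖ ^ 2) ^ (-α)) := by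
    refine Integrable.mul_prod (μ := volume) (ν := volume) (f := (Set.Icc (-1 : ℝ) 1).indicator 1)
      ?_ (integrable_japanese hα)
    rw [integrable_indicator_iff measurableSet_Icc]
    exact integrableOn_const (by simp)
  have hlim : ∀ᵐ y : ℝ × EuclideanSpace ℝ (Fin n),
      Tendsto (fun τ => profileIntegrand n α τ y) (𝓝[>] 0)
      (𝓝 ((Set.Ioo (0 : ℝ) 1).indicator (fun a => (1 + (a⁻¹ ^ 2 * ‖y.2‖ ^ 2)) ^ (-α)) y.1)) := by
    filter_upwards [hne 0, hne 1, hne (-1)] with y h0 h1 h2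
    exact tendsto_profileIntegrand hα0 h0 h1 h2
  have hmeas : ∀ τ : ℝ, AEStronglyMeasurable (profileIntegrand n α τ) volume := by
    intro τ
    refine (Measurable.indicator ?_ ?_).aestronglyMeasurable
    · fun_prop
    · exact (isOpen_lt (by fun_prop) continuous_const).measurableSet
  have hdom : ∀ᶠ τ in 𝓝[>] (0 : ℝ), ∀ᵐ y, ‖profileIntegrand n α τ y‖
      ≤ (Set.Icc (-1 : ℝ) 1).indicator 1 y.1 * (1 + ‖y.2‖ ^ 2) ^ (-α) := by
    filter_upwards [self_mem_nhdsWithin] with τ hτ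
    filter_upwards [hne 0] with y h0
    exact norm_profileIntegrand_le hα0 hτ h0
  have hT := (tendsto_integral_filter_of_dominated_convergence _
    (Eventually.of_forall hmeas) hdom hbound hlim).const_mul ((n : ℝ) + 1)
  have hint : Integrable (fun y : ℝ × EuclideanSpace ℝ (Fin n) =>
      (Set.Ioo (0 : ℝ) 1).indicator (fun a => (1 + (a⁻¹ ^ 2 * ‖y.2‖ ^ 2)) ^ (-α)) y.1) := by
    refine hbound.mono' (aestronglyMeasurable_of_tendsto_ae (𝓝[>] 0) hmeas hlim) ?_
    filter_upwards [hlim, hne 0] with y hy h0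
    refine le_of_tendsto hy.norm ?_
    filter_upwards [self_mem_nhdsWithin] with τ hτ
    exact norm_profileIntegrand_le hα0 hτ h0
  have hval : ∫ y : ℝ × EuclideanSpace ℝ (Fin n),
      (Set.Ioo (0 : ℝ) 1).indicator (fun a => (1 + (a⁻¹ ^ 2 * ‖y.2‖ ^ 2)) ^ (-α)) y.1
      = ((n : ℝ) + 1)⁻¹ * japaneseIntegral n α := by
    have hinner : ∀ a : ℝ, ∫ v : EuclideanSpace ℝ (Fin n),
        (Set.Ioo (0 : ℝ) 1).indicator (fun a => (1 + (a⁻¹ ^ 2 * ‖v‖ ^ 2)) ^ (-α)) a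
        = (Set.Ioo (0 : ℝ) 1).indicator (fun a => a ^ n * japaneseIntegral n α) a := by
      intro a
      by_cases ha : a ∈ Set.Ioo (0 : ℝ) 1
      · simp only [Set.indicator_of_mem ha]
        have h := Measure.integral_comp_smul (volume : Measure (EuclideanSpace ℝ (Fin n)))
          (fun z => (1 + ‖z‖ ^ 2) ^ (-α)) a⁻¹
        have ha0 := ha.1
        simpa [norm_smul, mul_pow, abs_of_pos ha0, japaneseIntegral] using h
      · simp only [Set.indicator_of_notMem ha, integral_zero]
    rw [Measure.volume_eq_prod, integral_prod _ hint]
    simp only [hinner]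
    rw [integral_indicator measurableSet_Ioo, integral_mul_const, ← integral_Ioc_eq_integral_Ioo,
      ← intervalIntegral.integral_of_le zero_le_one, integral_pow]
    simp
  rw [hval, mul_inv_cancel_left₀ (by positivity)] at hT
  exact hT

end Profile

/-! ### The derivative of the field `p - P p / |P p|` for a projection `P`. -/

section RadialField

variable {E : Type*} [NormedAddCommGroup E] [InnerProductSpace ℝ E]

/-- The field `p - P p / |P p|`. -/
def radialField (P : E →L[ℝ] E) (p : E) : E := p - (‖P p‖ ^ 1)⁻¹ • P p

/-- The derivative of `radialField`. -/
def radialFieldDeriv (P : E →L[ℝ] E) (p : E) : E →L[ℝ] E :=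
  ContinuousLinearMap.id ℝ E - ((‖P p‖ ^ 1)⁻¹ • P
    + (((-((1 : ℕ) : ℝ) * (‖P p‖ ^ (1 + 2))⁻¹) • innerForm E (P p)).comp P).smulRight (P p))

theorem hasFDerivAt_radialField {P : E →L[ℝ] E} {p : E} (hp : P p ≠ 0) :
    HasFDerivAt (radialField P) (radialFieldDeriv P p) p := by
  -- The exponent `1` written in `radialField` matches the kernel lemma at `k = 1`.
  have h1 := (hasFDerivAt_inv_norm_pow 1 hp).comp p P.hasFDerivAt
  exact (hasFDerivAt_id p).sub (h1.smul P.hasFDerivAt)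

/-- `P` sends the field to a multiple of `P p`, and `P p / |P p|` does not change to first order
when `P p` is stretched; only the identity part of the derivative acts. -/
theorem radialFieldDeriv_radialField {P : E →L[ℝ] E} (hP : ∀ p, P (P p) = P p) {p : E}
    (hp : P p ≠ 0) : radialFieldDeriv P p (radialField P p) = radialField P p := by
  have hs : 0 < ‖P p‖ := norm_pos_iff.2 hp
  have hproj : P (radialField P p) = (1 - ‖P p‖⁻¹) • P p := by
    rw [radialField, map_sub, map_smul, hP, sub_smul, one_smul, pow_one]
  have hcoef : (‖P p‖ ^ 1)⁻¹ * (1 - ‖P p‖⁻¹)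
      + -((1 : ℕ) : ℝ) * (‖P p‖ ^ (1 + 2))⁻¹ * ((1 - ‖P p‖⁻¹) * ‖P p‖ ^ 2) = 0 := by
    push_cast
    field_simp
    ring
  simp only [radialFieldDeriv, sub_apply, add_apply, smul_apply, ContinuousLinearMap.id_apply,
    ContinuousLinearMap.smulRight_apply, ContinuousLinearMap.comp_apply, innerForm_apply,
    real_inner_smul_right, real_inner_self_eq_norm_sq, hproj, smul_smul, smul_eq_mul]
  rw [← add_smul, hcoef, zero_smul, sub_zero]

theorem trace_radialFieldDeriv [FiniteDimensional ℝ E] {P : E →L[ℝ] E} (hP : ∀ p, P (P p) = P p)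
    {p : E} (hp : P p ≠ 0) : LinearMap.trace ℝ E (radialFieldDeriv P p)
      = Module.finrank ℝ E - (LinearMap.trace ℝ E P - 1) / ‖P p‖ := by
  have hs : 0 < ‖P p‖ := norm_pos_iff.2 hp
  have hlin : (radialFieldDeriv P p : E →ₗ[ℝ] E) = LinearMap.id
      - ((‖P p‖ ^ 1)⁻¹ • (P : E →ₗ[ℝ] E)
        + ((((-((1 : ℕ) : ℝ) * (‖P p‖ ^ (1 + 2))⁻¹) • innerForm E (P p)).comp P :
          E →L[ℝ] ℝ) : E →ₗ[ℝ] ℝ).smulRight (P p)) := rfl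
  rw [hlin, map_sub, map_add, map_smul, LinearMap.trace_id, LinearMap.trace_smulRight]
  simp only [ContinuousLinearMap.coe_coe, ContinuousLinearMap.comp_apply, smul_apply,
    innerForm_apply, hP, real_inner_self_eq_norm_sq, smul_eq_mul]
  push_cast
  field_simp
  ring

end RadialField

/-! ### Distance to the removed sphere and Euclidean geometry of the tubes. -/

section Tube

variable {n m : ℕ}

/-- The distance to the removed sphere. -/
def tubeRadius (p : Space n m) : ℝ := √((‖p.fst‖ - 1) ^ 2 + ‖p.snd‖ ^ 2)

/-- The projection `(x, y) ↦ (x, 0)`. -/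
def equatorialProj (n m : ℕ) : Space n m →L[ℝ] Space n m :=
  (equatorial n m).comp (WithLp.fstL 2 ℝ _ _)

/-- The radial field `(x - x/|x|, y)` of the tubes around the removed sphere. -/
def tubeField (p : Space n m) : Space n m := radialField (equatorialProj n m) p

theorem norm_sq_space (p : Space n m) : ‖p‖ ^ 2 = ‖p.fst‖ ^ 2 + ‖p.snd‖ ^ 2 :=
  WithLp.prod_norm_sq_eq_of_L2 p

theorem inner_space (p q : Space n m) :
    inner ℝ p q = inner ℝ p.fst q.fst + inner ℝ p.snd q.snd := WithLp.prod_inner_apply p q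

@[simp]
theorem equatorialProj_fst (p : Space n m) : (equatorialProj n m p).fst = p.fst := rfl

@[simp]
theorem equatorialProj_snd (p : Space n m) : (equatorialProj n m p).snd = 0 := rfl

theorem norm_equatorialProj (p : Space n m) : ‖equatorialProj n m p‖ = ‖p.fst‖ := by
  have h := norm_sq_space (equatorialProj n m p)
  rw [equatorialProj_fst, equatorialProj_snd, norm_zero] at h
  exact (pow_left_inj₀ (norm_nonneg _) (norm_nonneg _) two_ne_zero).1 (by linarith)

theorem equatorialProj_ne_zero {p : Space n m} (hx : p.fst ≠ 0) : equatorialProj n m p ≠ 0 := by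
  rw [← norm_ne_zero_iff, norm_equatorialProj]
  exact norm_ne_zero_iff.2 hx

theorem tubeField_fst (p : Space n m) : (tubeField p).fst = (1 - ‖p.fst‖⁻¹) • p.fst := by
  simp [tubeField, radialField, norm_equatorialProj, sub_smul]

theorem tubeField_snd (p : Space n m) : (tubeField p).snd = p.snd := by
  simp [tubeField, radialField]

theorem tubeRadius_sq (p : Space n m) : tubeRadius p ^ 2 = (‖p.fst‖ - 1) ^ 2 + ‖p.snd‖ ^ 2 :=
  Real.sq_sqrt (by positivity)

theorem tubeRadius_nonneg (p : Space n m) : 0 ≤ tubeRadius p := Real.sqrt_nonneg _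

theorem continuous_tubeRadius : Continuous (tubeRadius : Space n m → ℝ) := by
  unfold tubeRadius
  fun_prop

theorem tubeRadius_pos_iff {p : Space n m} : 0 < tubeRadius p ↔ p ∈ manifold n m := by
  rw [tubeRadius, Real.sqrt_pos]
  constructor
  · rintro h ⟨h1, h2⟩
    rw [h1, h2] at h
    simp at h
  · intro h
    by_contra hle
    have h1 := sq_nonneg (‖p.fst‖ - 1)
    have h2 := sq_nonneg ‖p.snd‖
    have h3 : ‖p.fst‖ - 1 = 0 := pow_eq_zero_iff two_ne_zero |>.1 (by linarith)
    have h4 : ‖p.snd‖ = 0 := pow_eq_zero_iff two_ne_zero |>.1 (by linarith)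
    exact h ⟨by linarith, norm_eq_zero.1 h4⟩

theorem abs_norm_fst_sub_one_le (p : Space n m) : |‖p.fst‖ - 1| ≤ tubeRadius p := by
  refine Real.abs_le_sqrt ?_
  have := sq_nonneg ‖p.snd‖
  linarith

theorem norm_tubeField_sq {p : Space n m} (hx : p.fst ≠ 0) :
    ‖tubeField p‖ ^ 2 = tubeRadius p ^ 2 := by
  have hs : 0 < ‖p.fst‖ := norm_pos_iff.2 hx
  rw [norm_sq_space, tubeField_fst, tubeField_snd, tubeRadius_sq, norm_smul, mul_pow,
    Real.norm_eq_abs, sq_abs]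
  congr 1
  field_simp

/-- The sign makes the function grow towards the removed sphere. The gradient does not depend on
`c`, so `c = r²` serves to cut out `T_r` and `c = 0` to define the foliation. -/
theorem hasFDerivAt_tubeRadius_sq {p : Space n m} (hx : p.fst ≠ 0) (c : ℝ) :
    HasFDerivAt (fun p : Space n m => (c - tubeRadius p ^ 2) / 2)
      (innerForm (Space n m) (-tubeField p)) p := by
  have hs : 0 < ‖p.fst‖ := norm_pos_iff.2 hx
  have h1 : HasFDerivAt (fun p : Space n m => ‖p‖ ^ 2) (2 • innerForm (Space n m) p) p :=
    (hasStrictFDerivAt_norm_sq p).hasFDerivAt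
  have hfst : HasFDerivAt (fun p : Space n m => p.fst)
      (WithLp.fstL 2 ℝ (EuclideanSpace ℝ (Fin (n + 1))) (EuclideanSpace ℝ (Fin (m + 1)))) p :=
    (WithLp.fstL 2 ℝ _ _).hasFDerivAt
  have h2 := hfst.norm_sq
  have h3 := (Real.hasDerivAt_sqrt (pow_pos hs 2).ne').comp_hasFDerivAt p h2
  -- Uses `r² = |p|² - 2 |x| + 1`.
  have h4 := ((h1.sub (h3.const_mul 2)).const_sub (c - 1)).const_mul (1 / 2)
  refine (h4.congr_of_eventuallyEq (Eventually.of_forall fun q => ?_)).congr_fderiv ?_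
  · simp only [tubeRadius_sq, Pi.sub_apply, Function.comp_apply, norm_sq_space,
      Real.sqrt_sq (norm_nonneg _)]
    ring
  · ext v
    have hv := inner_space (tubeField p) v
    rw [tubeField_fst, tubeField_snd, real_inner_smul_left] at hv
    rw [innerForm_apply, inner_neg_left, hv]
    have hv2 := inner_space p v
    simp only [Real.sqrt_sq hs.le, smul_apply, sub_apply, neg_apply, innerForm_apply, nsmul_eq_mul,
      smul_eq_mul, ContinuousLinearMap.comp_apply, innerSL_apply_apply, hv2, Nat.cast_ofNat]
    simp only [WithLp.fstL_apply]
    field_simp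
    ring

theorem trace_equatorialProj : LinearMap.trace ℝ (Space n m) (equatorialProj n m) = n + 1 := by
  have h := LinearMap.trace_comp_comm' (R := ℝ) (equatorial n m).toLinearMap
    (WithLp.fstL 2 ℝ (EuclideanSpace ℝ (Fin (n + 1)))
      (EuclideanSpace ℝ (Fin (m + 1)))).toLinearMap
  have h2 : (WithLp.fstL 2 ℝ (EuclideanSpace ℝ (Fin (n + 1)))
      (EuclideanSpace ℝ (Fin (m + 1)))).toLinearMap ∘ₗ (equatorial n m).toLinearMap
      = LinearMap.id := rfl
  rw [h2, LinearMap.trace_id, finrank_euclideanSpace_fin, Nat.cast_add_one] at h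
  exact h.symm

theorem hasFDerivAt_half_norm_sq (q : Space n m) (c : ℝ) :
    HasFDerivAt (fun p : Space n m => (‖p‖ ^ 2 - c) / 2) (innerForm (Space n m) q) q := by
  have h1 : HasFDerivAt (fun p : Space n m => ‖p‖ ^ 2) (2 • innerForm (Space n m) q) q :=
    (hasStrictFDerivAt_norm_sq q).hasFDerivAt
  refine (((h1.sub_const c).const_mul (1 / 2)).congr_of_eventuallyEq
    (Eventually.of_forall fun q => by simp only; ring)).congr_fderiv ?_
  ext v
  simp
  ring

theorem fderiv_norm_sq_ne_zero {p : Space n m} (hp : p ≠ 0) (c : ℝ) :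
    fderiv ℝ (fun p : Space n m => (‖p‖ ^ 2 - c) / 2) p ≠ 0 :=
  fderiv_ne_zero_of_innerForm (hasFDerivAt_half_norm_sq p c) hp

/-- The sign of the mean curvature of the tubes around the removed sphere. -/
theorem meanCurvature_tube_pos {w ε : ℝ} (hw : 0 < w) (hε : 0 < ε) (hn : 1 ≤ n)
    {p : Space n m} (hp : p ∈ manifold n m) (hx : p.fst ≠ 0) (c : ℝ)
    (hpos : 0 < ((n : ℝ) + m) * (1 + ε * (w * potential n m p)) * (-(m + 1 + n * (1 - ‖p.fst‖⁻¹)))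
      + 2 * (n + m + 1) * (ε * (w * fderiv ℝ (potential n m) p (-tubeField p)))) :
    0 < meanCurvature (metric n m w ε) (fun p => (c - tubeRadius p ^ 2) / 2) p := by
  have hopen : ∀ᶠ q : Space n m in 𝓝 p, q.fst ≠ 0 :=
    (isOpen_ne_fun (by fun_prop) continuous_const).mem_nhds hx
  have hx' := equatorialProj_ne_zero hx
  have hZ : HasFDerivAt tubeField _ p := hasFDerivAt_radialField hx'
  have hr := tubeRadius_pos_iff.2 hp
  have hn2 := norm_tubeField_sq hx
  have hne : ‖tubeField p‖ ^ 2 ≠ 0 := by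
    rw [hn2]
    positivity
  have hZ0 : tubeField p ≠ 0 := by
    intro h
    simp [h] at hne
  have h1 : LinearMap.trace ℝ (Space n m) (-radialFieldDeriv (equatorialProj n m) p).toLinearMap
      = -(n + m + 2 - n / ‖p.fst‖) := by
    have h := trace_radialFieldDeriv (P := equatorialProj n m) (fun _ => rfl) hx'
    rw [trace_equatorialProj, finrank_space, norm_equatorialProj, add_sub_cancel_right] at h
    rw [← h, ← map_neg]
    rfl
  have h2 : (-radialFieldDeriv (equatorialProj n m) p) (-tubeField p) = tubeField p := by
    rw [neg_apply, map_neg, neg_neg]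
    exact radialFieldDeriv_radialField (fun _ => rfl) hx'
  -- For the outward normal, `T_r` has `m + 1` principal curvatures `1/r` and `n` equal to `(|x| -
  -- 1) / (r |x|)`. The inward field has length `r`, so the result is minus `r` times their sum.
  have h3 : LinearMap.trace ℝ (Space n m) (-radialFieldDeriv (equatorialProj n m) p).toLinearMap
      - inner ℝ (-tubeField p) ((-radialFieldDeriv (equatorialProj n m) p) (-tubeField p))
        / ‖-tubeField p‖ ^ 2 = -(m + 1 + n * (1 - ‖p.fst‖⁻¹)) := by
    rw [h1, h2, norm_neg, inner_neg_left, real_inner_self_eq_norm_sq, neg_div, div_self hne]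
    ring
  exact meanCurvature_metric_pos hw hε hn hp
    (hopen.mono fun q hq => hasFDerivAt_tubeRadius_sq hq c) hZ.neg (neg_ne_zero.2 hZ0) h3 hpos

end Tube

/-! ### Distances to points of the removed sphere, and large coordinate spheres. -/

section SphereMeanCurvature

variable {n m : ℕ}

/-- All dependence on `q` sits in the distance from `q` to the direction `x/|x|`; this makes the
potential zonal and produces the scale `r / √|x|`. -/
theorem sub_equatorial_norm_sq {p : Space n m} (hx : p.fst ≠ 0)
    {q : EuclideanSpace ℝ (Fin (n + 1))} (hq : ‖q‖ = 1) :
    ‖p - equatorial n m q‖ ^ 2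
      = tubeRadius p ^ 2 + ‖p.fst‖ * ‖‖p.fst‖⁻¹ • p.fst - q‖ ^ 2 := by
  have hs : 0 < ‖p.fst‖ := norm_pos_iff.2 hx
  rw [norm_sq_space, tubeRadius_sq, WithLp.sub_fst, WithLp.sub_snd, equatorial_fst, equatorial_snd,
    sub_zero, norm_sub_sq_real, norm_sub_sq_real, norm_smul, norm_inv, norm_norm,
    inv_mul_cancel₀ hs.ne', real_inner_smul_left, hq]
  field_simp
  ring

/-- The term `r²` gives the main part of the derivative of the potential; the other carries the
factor `|x| - 1`, at most `r` in absolute value, and becomes an error. -/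
theorem inner_sub_equatorial_tubeField {p : Space n m} (hx : p.fst ≠ 0)
    {q : EuclideanSpace ℝ (Fin (n + 1))} (hq : ‖q‖ = 1) :
    inner ℝ (p - equatorial n m q) (tubeField p)
      = tubeRadius p ^ 2 + (‖p.fst‖ - 1) * ‖‖p.fst‖⁻¹ • p.fst - q‖ ^ 2 / 2 := by
  have hs : 0 < ‖p.fst‖ := norm_pos_iff.2 hx
  rw [inner_space, tubeField_fst, tubeField_snd, tubeRadius_sq, WithLp.sub_fst, WithLp.sub_snd,
    equatorial_fst, equatorial_snd, sub_zero, norm_sub_sq_real, norm_smul, norm_inv, norm_norm,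
    inv_mul_cancel₀ hs.ne', real_inner_smul_left, hq, inner_sub_left, real_inner_smul_right,
    real_inner_smul_right, real_inner_self_eq_norm_sq, real_inner_self_eq_norm_sq,
    real_inner_comm p.fst q]
  field_simp
  ring

theorem norm_sub_equatorial_ge (p : Space n m) {q : EuclideanSpace ℝ (Fin (n + 1))}
    (hq : ‖q‖ = 1) : ‖p‖ - 1 ≤ ‖p - equatorial n m q‖ := by
  have h := norm_sq_space (equatorial n m q)
  rw [equatorial_fst, equatorial_snd, norm_zero, hq] at h
  have h1 : ‖equatorial n m q‖ = 1 :=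
    (pow_left_inj₀ (norm_nonneg _) zero_le_one two_ne_zero).1 (by linarith)
  have := norm_sub_norm_le p (equatorial n m q)
  linarith

theorem abs_fderiv_potential_self_le {p : Space n m} (hn : 1 ≤ n) (hp : 2 ≤ ‖p‖) (hpM : p ∈ manifold n m) :
    |fderiv ℝ (potential n m) p p|
      ≤ ((n : ℝ) + m) * (2 / (‖p‖ - 1) * (surfaceMeasure n).real Set.univ) := by
  rw [fderiv_potential_apply hpM, abs_mul, abs_neg, abs_of_nonneg (by positivity : (0 : ℝ) ≤ n + m)]
  refine mul_le_mul_of_nonneg_left ?_ (by positivity)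
  rw [← Real.norm_eq_abs]
  refine norm_integral_le_of_norm_le_const (ae_of_all _ fun q => ?_)
  have hq : ‖(q : EuclideanSpace ℝ (Fin (n + 1)))‖ = 1 := norm_eq_of_mem_sphere q
  have hge := norm_sub_equatorial_ge p hq
  have hR : 1 ≤ ‖p‖ - 1 := by linarith
  set N := ‖p - equatorial n m q‖ with hN
  have hN1 : 1 ≤ N := hR.trans hge
  have hinner : |inner ℝ (p - equatorial n m q) p| ≤ N * ‖p‖ := abs_real_inner_le_norm _ _
  rw [norm_mul, norm_inv, Real.norm_eq_abs, Real.norm_eq_abs, abs_of_nonneg (by positivity)]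
  calc (N ^ (n + m + 2))⁻¹ * |inner ℝ (p - equatorial n m q) p|
      ≤ (N ^ (n + m + 2))⁻¹ * (N * ‖p‖) := by gcongr
    -- `N ≥ 1`, and `n ≥ 1` gives `n + m + 2 ≥ 3`.
    _ ≤ (N ^ 3)⁻¹ * (N * ‖p‖) := by
        gcongr
        omega
    _ = ‖p‖ / N ^ 2 := by field_simp
    _ ≤ ‖p‖ / (‖p‖ - 1) ^ 2 := by gcongr
    _ ≤ 2 / (‖p‖ - 1) := by
        rw [div_le_div_iff₀ (by positivity) (by linarith)]
        nlinarith

/-- Large spheres have positive mean curvature. -/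
theorem meanCurvature_sphere_pos {w ε : ℝ} (hw : 0 < w) (hε : 0 < ε) (hn : 1 ≤ n)
    {p : Space n m} (hp : 2 ≤ ‖p‖)
    (hlarge : 4 * ε * w * (surfaceMeasure n).real Set.univ < ‖p‖ - 1) (c : ℝ) :
    0 < meanCurvature (metric n m w ε) (fun p => (‖p‖ ^ 2 - c) / 2) p := by
  have hpM : p ∈ manifold n m := by
    rw [mem_manifold_iff]
    intro q hq h
    have := norm_sub_equatorial_ge p hq
    rw [h, norm_zero] at this
    linarith
  have hφ : ∀ q : Space n m, HasFDerivAt (fun p : Space n m => (‖p‖ ^ 2 - c) / 2)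
      (innerForm (Space n m) (id q)) q := fun q => hasFDerivAt_half_norm_sq q c
  have hp0 : p ≠ 0 := by
    rintro rfl
    simp at hp
    linarith
  have hpn : ‖p‖ ^ 2 ≠ 0 := pow_ne_zero _ (norm_ne_zero_iff.2 hp0)
  refine meanCurvature_metric_pos hw hε hn hpM (Eventually.of_forall hφ) (hasFDerivAt_id p) hp0
    (h := (n : ℝ) + m + 1) ?_ ?_
  · have : LinearMap.trace ℝ (Space n m) (ContinuousLinearMap.id ℝ (Space n m)).toLinearMap
        = n + m + 2 := by
      rw [← finrank_space, ← LinearMap.trace_id]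
      rfl
    rw [this]
    simp only [id, ContinuousLinearMap.id_apply, real_inner_self_eq_norm_sq, div_self hpn]
    ring
  · have hD := (abs_le.1 (abs_fderiv_potential_self_le hn hp hpM)).1
    have hP := potential_nonneg p
    have hn' : (1 : ℝ) ≤ n := by exact_mod_cast hn
    have hm' : (0 : ℝ) ≤ m := by positivity
    have hR : 0 < ‖p‖ - 1 := by linarith
    set S := (surfaceMeasure n).real Set.univ
    set D := fderiv ℝ (potential n m) p p with hDdef
    have hk : 0 < ((n : ℝ) + m) := by positivity
    -- This makes the derivative term exceed `-k (k + 1)` with `k = n + m`, while the Euclidean term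
    -- is at least `k (k + 1)` since `U ≥ 1`.
    have h1 : ε * w * (2 / (‖p‖ - 1) * S) < 1 / 2 := by
      have : ε * w * (2 / (‖p‖ - 1) * S) = (4 * ε * w * S) / (‖p‖ - 1) / 2 := by
        field_simp
        ring
      rw [this]
      have : 4 * ε * w * S / (‖p‖ - 1) < 1 := (div_lt_one hR).2 hlarge
      linarith
    have h2 : -((n + m) * (1 / 2)) < ε * (w * D) := by
      have h3 : ε * w * (-((n + m) * (2 / (‖p‖ - 1) * S))) ≤ ε * w * D :=
        mul_le_mul_of_nonneg_left hD (by positivity)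
      have h4 := mul_lt_mul_of_pos_left h1 hk
      linarith
    have h5 : 0 ≤ ((n : ℝ) + m) * (ε * (w * potential n m p)) * (n + m + 1) := by positivity
    have h6 := mul_lt_mul_of_pos_left h2 (by positivity : (0 : ℝ) < 2 * (n + m + 1))
    change 0 < _ + 2 * ((n : ℝ) + m + 1) * (ε * (w * D))
    nlinarith

end SphereMeanCurvature

/-! ### Asymptotics of the potential near the removed sphere. -/

section TubeAsymptotics

variable {n m : ℕ}

theorem inv_pow_eq_of_sq_eq {N r b : ℝ} (hN : 0 ≤ N) (hr : 0 < r) (hb : 0 < b)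
    (h : N ^ 2 = r ^ 2 * b) (k : ℕ) : (N ^ k)⁻¹ = (r ^ k)⁻¹ * b ^ (-((k : ℝ) / 2)) := by
  have h1 : N = r * √b := by
    rw [← Real.sqrt_sq hN, h, Real.sqrt_mul (by positivity), Real.sqrt_sq hr.le]
  have h2 : √b ^ k = b ^ ((k : ℝ) / 2) := by
    rw [Real.sqrt_eq_rpow, ← Real.rpow_mul_natCast hb.le]
    congr 1
    ring
  rw [h1, mul_pow, mul_inv, h2, Real.rpow_neg hb.le]

theorem tubeRadius_pow_mul_scale {r s : ℝ} (hr : 0 < r) (hs : 0 < s) :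
    r ^ m * ((r ^ (n + m))⁻¹ * (r / √s) ^ n) = (√s ^ n)⁻¹ := by
  have : 0 < √s := Real.sqrt_pos.2 hs
  rw [div_pow, pow_add]
  field_simp

theorem sub_equatorial_norm_sq' {p : Space n m} (hp : p ∈ manifold n m) (hx : p.fst ≠ 0)
    {q : EuclideanSpace ℝ (Fin (n + 1))} (hq : ‖q‖ = 1) :
    ‖p - equatorial n m q‖ ^ 2 = tubeRadius p ^ 2 *
      (1 + ‖‖p.fst‖⁻¹ • p.fst - q‖ ^ 2 / (tubeRadius p / √‖p.fst‖) ^ 2) := by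
  have hs : 0 < ‖p.fst‖ := norm_pos_iff.2 hx
  have hr := tubeRadius_pos_iff.2 hp
  rw [sub_equatorial_norm_sq hx hq, div_pow, Real.sq_sqrt hs.le]
  field_simp

/-- With `τ = r / √|x|` one has `|p - q|² = r² (1 + |e - q|² / τ²)`, `e = x/|x|`, so `r^m P` is
exactly a profile value and `tendsto_profile` gives its limit `κ`. -/
theorem potential_eq_profile {p : Space n m} (hp : p ∈ manifold n m) (hx : p.fst ≠ 0) :
    tubeRadius p ^ m * potential n m p
      = (√‖p.fst‖ ^ n)⁻¹ * profile n (((n : ℝ) + m) / 2) (tubeRadius p / √‖p.fst‖) := by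
  have hs : 0 < ‖p.fst‖ := norm_pos_iff.2 hx
  have hr := tubeRadius_pos_iff.2 hp
  have hτ : 0 < tubeRadius p / √‖p.fst‖ := div_pos hr (Real.sqrt_pos.2 hs)
  have he : ‖‖p.fst‖⁻¹ • p.fst‖ = 1 := by
    rw [norm_smul, norm_inv, norm_norm, inv_mul_cancel₀ hs.ne']
  have h1 : potential n m p = (tubeRadius p ^ (n + m))⁻¹ *
      ((tubeRadius p / √‖p.fst‖) ^ n
        * profile n (((n : ℝ) + m) / 2) (tubeRadius p / √‖p.fst‖)) := by
    rw [← integral_sphere_eq_profile he hτ, potential, ← integral_const_mul]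
    refine integral_congr_ae (ae_of_all _ fun q => ?_)
    have h := inv_pow_eq_of_sq_eq (norm_nonneg _) hr (by positivity)
      (sub_equatorial_norm_sq' hp hx (norm_eq_of_mem_sphere q)) (n + m)
    rw [Nat.cast_add] at h
    exact h
  rw [h1, ← tubeRadius_pow_mul_scale (m := m) hr hs]
  ring

/-- A lower bound suffices. With `b = |p - q|² / r²` and `d = |e - q|`, the term with `|x| - 1` is
controlled by `|x| d² / r² ≤ b`, which raises the exponent by one and turns the error into a
multiple of the profile of the potential itself. -/
theorem fderiv_potential_tubeField_ge {p : Space n m} (hp : p ∈ manifold n m) (hx : p.fst ≠ 0) :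
    ((n : ℝ) + m) * ((√‖p.fst‖ ^ n)⁻¹
      * (profile n (((n : ℝ) + m) / 2 + 1) (tubeRadius p / √‖p.fst‖)
        - |‖p.fst‖ - 1| / (2 * ‖p.fst‖)
          * profile n (((n : ℝ) + m) / 2) (tubeRadius p / √‖p.fst‖)))
      ≤ tubeRadius p ^ m * fderiv ℝ (potential n m) p (-tubeField p) := by
  have hs : 0 < ‖p.fst‖ := norm_pos_iff.2 hx
  have hr := tubeRadius_pos_iff.2 hp
  have hss : 0 < √‖p.fst‖ := Real.sqrt_pos.2 hs
  have hτ : 0 < tubeRadius p / √‖p.fst‖ := div_pos hr hss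
  have he : ‖‖p.fst‖⁻¹ • p.fst‖ = 1 := by
    rw [norm_smul, norm_inv, norm_norm, inv_mul_cancel₀ hs.ne']
  have hcont : ∀ β : ℝ, Continuous fun q : Metric.sphere (0 : EuclideanSpace ℝ (Fin (n + 1))) 1 =>
      (1 + ‖‖p.fst‖⁻¹ • p.fst - (q : EuclideanSpace ℝ (Fin (n + 1)))‖ ^ 2
        / (tubeRadius p / √‖p.fst‖) ^ 2) ^ β := fun β =>
    Continuous.rpow_const (by fun_prop) fun q => Or.inl (by positivity)
  have hint : ∀ β : ℝ, Integrable (fun q : Metric.sphere (0 : EuclideanSpace ℝ (Fin (n + 1))) 1 =>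
      (1 + ‖‖p.fst‖⁻¹ • p.fst - (q : EuclideanSpace ℝ (Fin (n + 1)))‖ ^ 2
        / (tubeRadius p / √‖p.fst‖) ^ 2) ^ β) (surfaceMeasure n) := fun β =>
    (hcont β).integrable_of_hasCompactSupport (HasCompactSupport.of_compactSpace _)
  have key : (tubeRadius p ^ (n + m))⁻¹ * ((tubeRadius p / √‖p.fst‖) ^ n
        * profile n (((n : ℝ) + m) / 2 + 1) (tubeRadius p / √‖p.fst‖)
        - |‖p.fst‖ - 1| / (2 * ‖p.fst‖) * ((tubeRadius p / √‖p.fst‖) ^ n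
        * profile n (((n : ℝ) + m) / 2) (tubeRadius p / √‖p.fst‖)))
      ≤ ∫ q : Metric.sphere (0 : EuclideanSpace ℝ (Fin (n + 1))) 1,
        (‖p - equatorial n m q‖ ^ (n + m + 2))⁻¹ * inner ℝ (p - equatorial n m q) (tubeField p)
          ∂surfaceMeasure n := by
    rw [← integral_sphere_eq_profile he hτ, ← integral_sphere_eq_profile he hτ,
      ← integral_const_mul, ← integral_sub (hint _) ((hint _).const_mul _), ← integral_const_mul]
    refine integral_mono (((hint _).sub ((hint _).const_mul _)).const_mul _) ?_ fun q => ?_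
    · refine Continuous.integrable_of_hasCompactSupport ?_ (HasCompactSupport.of_compactSpace _)
      have h1 : Continuous fun q : Metric.sphere (0 : EuclideanSpace ℝ (Fin (n + 1))) 1 =>
          p - equatorial n m q := by fun_prop
      exact ((h1.norm.pow _).inv₀ fun q => pow_ne_zero _
        (norm_ne_zero_iff.2 (sub_equatorial_ne_zero hp q))).mul (h1.inner continuous_const)
    · have hq : ‖(q : EuclideanSpace ℝ (Fin (n + 1)))‖ = 1 := norm_eq_of_mem_sphere q
      have hsq := sub_equatorial_norm_sq' hp hx hq
      have h := inv_pow_eq_of_sq_eq (norm_nonneg _) hr (by positivity) hsq (n + m + 2)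
      have hexp : -(((n + m + 2 : ℕ) : ℝ) / 2) = -(((n : ℝ) + m) / 2 + 1) := by
        push_cast
        ring
      simp only
      rw [h, hexp, inner_sub_equatorial_tubeField hx hq]
      have hbdef : 1 + ‖‖p.fst‖⁻¹ • p.fst - (q : EuclideanSpace ℝ (Fin (n + 1)))‖ ^ 2
        / (tubeRadius p / √‖p.fst‖) ^ 2 = 1 + ‖p.fst‖ *
          ‖‖p.fst‖⁻¹ • p.fst - (q : EuclideanSpace ℝ (Fin (n + 1)))‖ ^ 2 / tubeRadius p ^ 2 := by
        rw [div_pow, Real.sq_sqrt hs.le]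
        field_simp
      rw [hbdef]
      set d2 := ‖‖p.fst‖⁻¹ • p.fst - (q : EuclideanSpace ℝ (Fin (n + 1)))‖ ^ 2
      have hd2 : 0 ≤ d2 := by positivity
      set r := tubeRadius p
      set s := ‖p.fst‖
      set b := 1 + s * d2 / r ^ 2 with hb
      have hb0 : 0 < b := by positivity
      have hbb : b ^ (-(((n : ℝ) + m) / 2)) = b * b ^ (-(((n : ℝ) + m) / 2 + 1)) := by
        rw [neg_add', Real.rpow_sub_one hb0.ne']
        field_simp
      rw [hbb]
      have hc : 0 < b ^ (-(((n : ℝ) + m) / 2 + 1)) := Real.rpow_pos_of_pos hb0 _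
      set c := b ^ (-(((n : ℝ) + m) / 2 + 1))
      have h3 : c - |s - 1| / (2 * s) * (b * c)
          ≤ (r ^ 2)⁻¹ * c * (r ^ 2 + (s - 1) * d2 / 2) := by
        have h4 : (r ^ 2)⁻¹ * c * (r ^ 2 + (s - 1) * d2 / 2)
            = c + (s - 1) / (2 * s) * ((s * d2 / r ^ 2) * c) := by
          field_simp
        rw [h4]
        have h5 : -(|s - 1| / (2 * s)) ≤ (s - 1) / (2 * s) := by
          rw [← neg_div]
          gcongr
          exact neg_abs_le _
        have h6 : 0 ≤ (s * d2 / r ^ 2) * c := by positivity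
        have h7 := mul_le_mul_of_nonneg_right h5 h6
        have h8 : (s * d2 / r ^ 2) * c ≤ b * c := by
          rw [hb]
          nlinarith
        have h9 := mul_le_mul_of_nonneg_left h8 (by positivity : 0 ≤ |s - 1| / (2 * s))
        linarith
      calc (r ^ (n + m))⁻¹ * (c - |s - 1| / (2 * s) * (b * c))
          ≤ (r ^ (n + m))⁻¹ * ((r ^ 2)⁻¹ * c * (r ^ 2 + (s - 1) * d2 / 2)) := by gcongr
        _ = (r ^ (n + m + 2))⁻¹ * c * (r ^ 2 + (s - 1) * d2 / 2) := by
            rw [pow_add _ (n + m) 2, mul_inv]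
            ring
  have hneg : fderiv ℝ (potential n m) p (-tubeField p) = ((n : ℝ) + m) *
      ∫ q : Metric.sphere (0 : EuclideanSpace ℝ (Fin (n + 1))) 1,
        (‖p - equatorial n m q‖ ^ (n + m + 2))⁻¹ * inner ℝ (p - equatorial n m q) (tubeField p)
          ∂surfaceMeasure n := by
    rw [map_neg, fderiv_potential_apply hp]
    ring
  rw [hneg, ← tubeRadius_pow_mul_scale (m := m) hr hs]
  have h := mul_le_mul_of_nonneg_left key
    (by positivity : 0 ≤ ((n : ℝ) + m) * tubeRadius p ^ m)
  refine (le_of_eq ?_).trans (h.trans (le_of_eq ?_)) <;> ring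

theorem kappa_eq : kappa n m = japaneseIntegral n (((n : ℝ) + m) / 2) := rfl

theorem tubeConstant_pos (hn : 1 ≤ n) (hm : 1 ≤ m) : 0 < tubeConstant n m := by
  have hn' : (1 : ℝ) ≤ n := by exact_mod_cast hn
  have hm' : (1 : ℝ) ≤ m := by exact_mod_cast hm
  have hκ := japaneseIntegral_pos (n := n) (α := ((n : ℝ) + m) / 2) (by linarith)
  have h1 : 0 ≤ ((m : ℝ) - 1) * (n + m) := mul_nonneg (by linarith) (by positivity)
  rw [tubeConstant, kappa_eq]
  refine mul_pos hκ (div_pos ?_ (by positivity))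
  linarith

/-- Thin tubes around the removed sphere have positive mean curvature. -/
theorem exists_meanCurvature_tube_pos {w θ : ℝ} (hw : 0 < w) (hn : 1 ≤ n) (hm : 1 ≤ m)
    (hθC : θ < w * tubeConstant n m) :
    ∃ δ : ℝ, 0 < δ ∧ δ < 1 ∧ ∀ ε : ℝ, 0 < ε → ∀ p ∈ manifold n m, tubeRadius p < δ →
      tubeRadius p ^ m < θ * ε → ∀ c : ℝ,
      0 < meanCurvature (metric n m w ε) (fun p => (c - tubeRadius p ^ 2) / 2) p := by
  have hn' : (1 : ℝ) ≤ n := by exact_mod_cast hn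
  have hm' : (1 : ℝ) ≤ m := by exact_mod_cast hm
  have hα : (n : ℝ) / 2 < ((n : ℝ) + m) / 2 := by linarith
  have hκ := japaneseIntegral_pos hα
  have hL0 := tendsto_profile hα
  have hL1 := tendsto_profile (n := n) (α := ((n : ℝ) + m) / 2 + 1) (by linarith)
  have hκ1 : japaneseIntegral n (((n : ℝ) + m) / 2 + 1)
      = m / (n + m) * japaneseIntegral n (((n : ℝ) + m) / 2) := by
    have h := japaneseIntegral_add_one hα
    field_simp at h ⊢
    linarith
  have hs : Tendsto (fun z : ℝ × ℝ => z.1) (𝓝 1 ×ˢ 𝓝[>] 0) (𝓝 1) := tendsto_fst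
  have hτ : Tendsto (fun z : ℝ × ℝ => z.2) (𝓝 1 ×ˢ 𝓝[>] 0) (𝓝[>] 0) := tendsto_snd
  have hH : Tendsto (fun z : ℝ × ℝ => (m : ℝ) + 1 + n * (1 - z.1⁻¹)) (𝓝 1 ×ˢ 𝓝[>] 0)
      (𝓝 (m + 1 + n * (1 - (1 : ℝ)⁻¹))) :=
    (((hs.inv₀ one_ne_zero).const_sub 1).const_mul _).const_add _
  -- This is the sign condition times `r^m`, with `r^m` replaced by its bound `θ ε` and the
  -- derivative by its lower bound, divided by `(n + m) ε`. It involves only `|x| → 1` and `τ → 0+`,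
  -- so the resulting `δ` does not depend on `ε`.
  have hG := (((((hs.sqrt.pow n).inv₀ (by simp)).mul
    ((((hL1.comp hτ).sub ((((hs.sub_const 1).abs).div (hs.const_mul 2) (by norm_num)).mul
      (hL0.comp hτ))).const_mul (2 * ((n : ℝ) + m + 1))).sub (hH.mul (hL0.comp hτ)))).const_mul w).sub
        (hH.mul_const θ))
  -- The limit value equals `(m + 1) (w C - θ)`.
  have hpos : 0 < w * ((√1 ^ n)⁻¹ * (2 * ((n : ℝ) + m + 1) *
      (japaneseIntegral n (((n : ℝ) + m) / 2 + 1) - |1 - 1| / (2 * 1)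
        * japaneseIntegral n (((n : ℝ) + m) / 2))
      - (m + 1 + n * (1 - (1 : ℝ)⁻¹)) * japaneseIntegral n (((n : ℝ) + m) / 2)))
      - (m + 1 + n * (1 - (1 : ℝ)⁻¹)) * θ := by
    rw [tubeConstant, kappa_eq] at hθC
    rw [hκ1]
    simp only [Real.sqrt_one, one_pow, inv_one, one_mul, sub_self, abs_zero, zero_div, zero_mul,
      sub_zero, mul_zero, add_zero]
    generalize japaneseIntegral n (((n : ℝ) + m) / 2) = K at *
    have h1 : w * (K * ((((m : ℝ) - 1) * (n + m) + 2 * m) / ((m + 1) * (n + m))))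
        = w * (2 * ((n : ℝ) + m + 1) * (m / (n + m) * K) - (m + 1) * K) / (m + 1) := by
      field_simp
      ring
    rw [h1, lt_div_iff₀ (by positivity)] at hθC
    linarith
  have hHpos : (0 : ℝ) < m + 1 + n * (1 - (1 : ℝ)⁻¹) := by
    rw [inv_one, sub_self, mul_zero, add_zero]
    positivity
  have hev := (hG.eventually_const_lt hpos).and (hH.eventually_const_lt hHpos)
  obtain ⟨u, hu, v, hv, huv⟩ := Filter.eventually_prod_iff.1 hev
  obtain ⟨η, hη, hball⟩ := Metric.eventually_nhds_iff.1 hu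
  obtain ⟨η', hη', hIoo⟩ := mem_nhdsGT_iff_exists_Ioo_subset.1 hv
  have hη'0 : 0 < η' := hη'
  -- As `||x| - 1| ≤ r`, `r < 1/2` gives `√|x| > 1/2`, so `r < η'/2` forces `τ < η'`.
  refine ⟨min (1 / 2) (min η (η' / 2)), by positivity, (min_le_left _ _).trans_lt (by norm_num), ?_⟩
  intro ε hε p hp hδ hrε c
  have hr := tubeRadius_pos_iff.2 hp
  have h1 : tubeRadius p < 1 / 2 := hδ.trans_le (min_le_left _ _)
  have h2 : tubeRadius p < η := hδ.trans_le ((min_le_right _ _).trans (min_le_left _ _))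
  have h3 : tubeRadius p < η' / 2 := hδ.trans_le ((min_le_right _ _).trans (min_le_right _ _))
  have habs := abs_norm_fst_sub_one_le p
  have hs4 : 1 / 2 < ‖p.fst‖ := by
    have := (abs_le.1 habs).1
    linarith
  have hs0 : 0 < ‖p.fst‖ := by linarith
  have hx : p.fst ≠ 0 := norm_pos_iff.1 hs0
  have hsq : 1 / 2 < √‖p.fst‖ := by
    rw [Real.lt_sqrt (by norm_num)]
    linarith
  have hτlt : tubeRadius p / √‖p.fst‖ < η' := by
    rw [div_lt_iff₀ (by linarith)]
    nlinarith
  have hτ0 : 0 < tubeRadius p / √‖p.fst‖ := div_pos hr (by linarith)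
  obtain ⟨hGp, hHp⟩ := huv (hball (show dist ‖p.fst‖ 1 < η from habs.trans_lt h2))
    (hIoo ⟨hτ0, hτlt⟩)
  refine meanCurvature_tube_pos hw hε hn hp hx c ?_
  have hP := potential_eq_profile hp hx
  have hD := fderiv_potential_tubeField_ge hp hx
  simp only [Function.comp_apply, Pi.div_apply] at hGp hHp
  set L0 := profile n (((n : ℝ) + m) / 2) (tubeRadius p / √‖p.fst‖)
  set L1 := profile n (((n : ℝ) + m) / 2 + 1) (tubeRadius p / √‖p.fst‖)
  set H := (m : ℝ) + 1 + n * (1 - ‖p.fst‖⁻¹)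
  set D := fderiv ℝ (potential n m) p (-tubeField p)
  set P := potential n m p
  set σ := (√‖p.fst‖ ^ n)⁻¹
  set q := |‖p.fst‖ - 1| / (2 * ‖p.fst‖)
  set r := tubeRadius p
  have hk : 0 < (n : ℝ) + m := by positivity
  have hrm : 0 < r ^ m := by positivity
  refine pos_of_mul_pos_right ?_ hrm.le
  have e1 : r ^ m * (((n : ℝ) + m) * (1 + ε * (w * P)) * -H
      + 2 * (n + m + 1) * (ε * (w * D))) = ε * w * (2 * (n + m + 1) * (r ^ m * D)
        - (n + m) * H * (r ^ m * P)) - (n + m) * H * r ^ m := by ring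
  rw [e1, hP]
  have e2 : ε * w * (2 * ((n : ℝ) + m + 1)) * ((n + m) * (σ * (L1 - q * L0)))
      ≤ ε * w * (2 * (n + m + 1)) * (r ^ m * D) := mul_le_mul_of_nonneg_left hD (by positivity)
  have e3 : (n + m) * H * r ^ m < (n + m) * H * (θ * ε) :=
    mul_lt_mul_of_pos_left hrε (mul_pos hk hHp)
  have e4 := mul_pos (mul_pos hk hε) hGp
  have e5 : (n + m) * ε * (w * (σ * (2 * (n + m + 1) * (L1 - q * L0) - H * L0)) - H * θ)
      = ε * w * (2 * ((n : ℝ) + m + 1)) * ((n + m) * (σ * (L1 - q * L0)))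
        - ε * w * ((n + m) * H * (σ * L0)) - (n + m) * H * (θ * ε) := by ring
  rw [e5] at e4
  linarith

end TubeAsymptotics

/-! ### Ends from decreasing connected sets. -/

section Ends

variable {E : Type*} [NormedAddCommGroup E] {Ω : Set E}

/-- A decreasing sequence of connected sets which leaves every compact set defines an end. -/
theorem SpaceEnd.exists_of_antitone {A : ℕ → Set E} (hA : Antitone A)
    (hconn : ∀ j, IsConnected (A j))
    (hK : ∀ K : Set E, IsCompact K → K ⊆ Ω → ∃ j, A j ⊆ Ω \ K) :
    ∃ e : SpaceEnd Ω, ∀ K, ∃ j, A j ⊆ e.comp K := by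
  choose x hx using fun j => (hconn j).nonempty
  choose! j hj using hK
  have hsub : ∀ K : {K : Set E // IsCompact K ∧ K ⊆ Ω},
      A (j K.1) ⊆ connectedComponentIn (Ω \ K.1) (x (j K.1)) := fun K =>
    (hconn _).isPreconnected.subset_connectedComponentIn (hx _) (hj K.1 K.2.1 K.2.2)
  refine ⟨⟨fun K => connectedComponentIn (Ω \ K.1) (x (j K.1)),
    fun K => ⟨x (j K.1), hj K.1 K.2.1 K.2.2 (hx _), rfl⟩, fun K L hKL => ?_⟩,
    fun K => ⟨j K.1, hsub K⟩⟩
  -- A point of a later set lies in both chosen components, so both can be based there and compared.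
  have hxL : x (max (j K.1) (j L.1)) ∈ connectedComponentIn (Ω \ L.1) (x (j L.1)) :=
    hsub L (hA (le_max_right _ _) (hx _))
  have hxK : x (max (j K.1) (j L.1)) ∈ connectedComponentIn (Ω \ K.1) (x (j K.1)) :=
    hsub K (hA (le_max_left _ _) (hx _))
  rw [connectedComponentIn_eq hxL, connectedComponentIn_eq hxK]
  exact connectedComponentIn_mono _ (Set.sdiff_subset_sdiff_right hKL)

theorem connectedComponentIn_union_eq {A B : Set E} (hA : IsOpen A) (hB : IsOpen B)
    (hAB : Disjoint A B) (hconn : IsPreconnected A) {x : E} (hx : x ∈ A) :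
    connectedComponentIn (A ∪ B) x = A := by
  refine Set.Subset.antisymm ?_ (hconn.subset_connectedComponentIn hx Set.subset_union_left)
  exact isPreconnected_connectedComponentIn.subset_left_of_subset_union hA hB hAB
    (connectedComponentIn_subset _ _)
    ⟨x, mem_connectedComponentIn (Set.mem_union_left _ hx), hx⟩

theorem SpaceEnd.comp_eq_or_eq (e : SpaceEnd Ω) (K : {K : Set E // IsCompact K ∧ K ⊆ Ω})
    {A B : Set E} (hA : IsOpen A) (hB : IsOpen B) (hAB : Disjoint A B) (hcA : IsPreconnected A)
    (hcB : IsPreconnected B) (hK : Ω \ K.1 = A ∪ B) : e.comp K = A ∨ e.comp K = B := by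
  obtain ⟨x, hx, he⟩ := e.isComponent K
  rw [hK] at hx he
  rcases hx with hx | hx
  · exact Or.inl (he.trans (connectedComponentIn_union_eq hA hB hAB hcA hx))
  · rw [Set.union_comm] at he
    exact Or.inr (he.trans (connectedComponentIn_union_eq hB hA hAB.symm hcB hx))

end Ends

/-! ### Topology of the tubes and the two ends of `M`. -/

section TubeTopology

variable {n m : ℕ}

/-- The parametrization of the tubes around the removed sphere. -/
def tubeMap (n m : ℕ)
    (z : EuclideanSpace ℝ (Fin (n + 1)) × EuclideanSpace ℝ (Fin (m + 2)) × ℝ) : Space n m :=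
  WithLp.toLp 2 ((1 + z.2.2 * z.2.1 0) • z.1,
    z.2.2 • (WithLp.toLp 2 (fun i => z.2.1 i.succ) : EuclideanSpace ℝ (Fin (m + 1))))

theorem continuous_tubeMap : Continuous (tubeMap n m) := by
  unfold tubeMap
  fun_prop

theorem norm_sq_succ (η : EuclideanSpace ℝ (Fin (m + 2))) :
    ‖η‖ ^ 2 = η 0 ^ 2
      + ‖(WithLp.toLp 2 (fun i => η i.succ) : EuclideanSpace ℝ (Fin (m + 1)))‖ ^ 2 := by
  simp [EuclideanSpace.norm_sq_eq, Fin.sum_univ_succ]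

theorem norm_tubeMap_fst {θ : EuclideanSpace ℝ (Fin (n + 1))} {η : EuclideanSpace ℝ (Fin (m + 2))}
    {r : ℝ} (hθ : ‖θ‖ = 1) (hη : ‖η‖ = 1) (hr : 0 < r) (hr1 : r < 1) :
    0 < 1 + r * η 0 ∧ ‖(tubeMap n m (θ, η, r)).fst‖ = 1 + r * η 0 := by
  have h := norm_sq_succ η
  have h0 : |η 0| ≤ 1 := by
    rw [← sq_le_one_iff_abs_le_one]
    nlinarith [sq_nonneg ‖(WithLp.toLp 2 (fun i => η i.succ) : EuclideanSpace ℝ (Fin (m + 1)))‖]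
  have h1 := (abs_le.1 h0).1
  have h2 : 0 < 1 + r * η 0 := by nlinarith
  refine ⟨h2, ?_⟩
  change ‖(1 + r * η 0) • θ‖ = _
  rw [norm_smul, hθ, mul_one, Real.norm_of_nonneg h2.le]

theorem tubeRadius_tubeMap {θ : EuclideanSpace ℝ (Fin (n + 1))}
    {η : EuclideanSpace ℝ (Fin (m + 2))}
    {r : ℝ} (hθ : ‖θ‖ = 1) (hη : ‖η‖ = 1) (hr : 0 < r) (hr1 : r < 1) :
    tubeRadius (tubeMap n m (θ, η, r)) = r := by
  have h := norm_sq_succ η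
  have hsnd : (tubeMap n m (θ, η, r)).snd
      = r • (WithLp.toLp 2 (fun i => η i.succ) : EuclideanSpace ℝ (Fin (m + 1))) := rfl
  rw [tubeRadius, (norm_tubeMap_fst hθ hη hr hr1).2, hsnd, norm_smul, Real.norm_of_nonneg hr.le]
  have : (1 + r * η 0 - 1) ^ 2
      + (r * ‖(WithLp.toLp 2 (fun i => η i.succ) : EuclideanSpace ℝ (Fin (m + 1)))‖) ^ 2
      = r ^ 2 * ‖η‖ ^ 2 := by
    rw [h]
    ring
  rw [this, hη, one_pow, mul_one, Real.sqrt_sq hr.le]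

theorem fst_ne_zero_of_tubeRadius_lt {p : Space n m} (hp : tubeRadius p < 1) : p.fst ≠ 0 := by
  intro h
  have h1 := abs_norm_fst_sub_one_le p
  rw [h, norm_zero, zero_sub, abs_neg, abs_one] at h1
  linarith

theorem exists_tubeMap_eq {p : Space n m} (hp : 0 < tubeRadius p) (hp1 : tubeRadius p < 1) :
    ∃ θ η, ‖θ‖ = 1 ∧ ‖η‖ = 1 ∧ tubeMap n m (θ, η, tubeRadius p) = p := by
  have hs : 0 < ‖p.fst‖ := norm_pos_iff.2 (fst_ne_zero_of_tubeRadius_lt hp1)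
  set r := tubeRadius p with hr
  set η : EuclideanSpace ℝ (Fin (m + 2)) :=
    WithLp.toLp 2 (Fin.cons ((‖p.fst‖ - 1) / r) fun i => p.snd i / r) with hη
  have hη0 : η 0 = (‖p.fst‖ - 1) / r := rfl
  have hη1 : (WithLp.toLp 2 (fun i => η i.succ) : EuclideanSpace ℝ (Fin (m + 1)))
      = r⁻¹ • p.snd := by
    ext i
    simp [hη, div_eq_inv_mul]
  refine ⟨‖p.fst‖⁻¹ • p.fst, η, ?_, ?_, ?_⟩
  · rw [norm_smul, norm_inv, norm_norm, inv_mul_cancel₀ hs.ne']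
  · have h := norm_sq_succ η
    rw [hη0, hη1, norm_smul, norm_inv, Real.norm_of_nonneg hp.le] at h
    have h2 := tubeRadius_sq p
    rw [← hr] at h2
    have h3 : ‖η‖ ^ 2 = 1 ^ 2 := by
      rw [h]
      field_simp
      linarith
    exact (pow_left_inj₀ (norm_nonneg _) zero_le_one two_ne_zero).1 h3
  · apply WithLp.ofLp_injective
    refine Prod.ext ?_ ?_
    · change (1 + r * η 0) • (‖p.fst‖⁻¹ • p.fst) = p.fst
      rw [hη0, smul_smul]
      convert one_smul ℝ p.fst
      field_simp
      ring
    · change r • (WithLp.toLp 2 (fun i => η i.succ) : EuclideanSpace ℝ (Fin (m + 1))) = p.snd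
      rw [hη1, smul_smul, mul_inv_cancel₀ hp.ne', one_smul]

theorem tube_eq {r : ℝ} (hr : 0 < r) : tube n m r = {p | tubeRadius p = r} := by
  ext p
  simp only [tube, rotationSet, Set.mem_ofPred_eq, Set.mem_image]
  constructor
  · rintro ⟨s, -, hs⟩
    rw [Prod.mk.injEq] at hs
    rw [tubeRadius, ← hs.1, ← hs.2]
    have : (1 + r * Real.cos (s / r) - 1) ^ 2 + (r * Real.sin (s / r)) ^ 2 = r ^ 2 := by
      have := Real.sin_sq_add_cos_sq (s / r)
      linear_combination r ^ 2 * this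
    rw [this, Real.sqrt_sq hr.le]
  · intro h
    have habs := abs_norm_fst_sub_one_le p
    have hsq := tubeRadius_sq p
    rw [h] at habs hsq
    rw [abs_le] at habs
    -- The arc parameter is `r` times the angle; on `[0, π]` the sine is nonnegative, matching
    -- `‖p.snd‖`.
    refine ⟨r * Real.arccos ((‖p.fst‖ - 1) / r), ⟨by have := Real.arccos_nonneg ((‖p.fst‖ - 1) / r); positivity, ?_⟩, ?_⟩
    · rw [mul_comm]
      exact mul_le_mul_of_nonneg_right (Real.arccos_le_pi _) hr.le
    · rw [mul_div_cancel_left₀ _ hr.ne', Real.cos_arccos, Real.sin_arccos]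
      · refine Prod.ext ?_ ?_
        · simp only
          field_simp
          ring
        · simp only
          have h1 : 1 - ((‖p.fst‖ - 1) / r) ^ 2 = (‖p.snd‖ / r) ^ 2 := by
            field_simp
            linarith
          rw [h1, Real.sqrt_sq (by positivity)]
          field_simp
      · rw [le_div_iff₀ hr]
        linarith
      · rw [div_le_one hr]
        linarith

/-- A tube is homeomorphic to a product of two spheres. -/
theorem nonempty_tube_homeomorph {r : ℝ} (hr : 0 < r) (hr1 : r < 1) :
    Nonempty (tube n m r ≃ₜ Metric.sphere (0 : EuclideanSpace ℝ (Fin (n + 1))) 1 ×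
      Metric.sphere (0 : EuclideanSpace ℝ (Fin (m + 2))) 1) := by
  let F : Metric.sphere (0 : EuclideanSpace ℝ (Fin (n + 1))) 1 ×
      Metric.sphere (0 : EuclideanSpace ℝ (Fin (m + 2))) 1 → tube n m r := fun z =>
    ⟨tubeMap n m (z.1, z.2, r), by
      rw [tube_eq hr]
      exact tubeRadius_tubeMap (norm_eq_of_mem_sphere z.1) (norm_eq_of_mem_sphere z.2) hr hr1⟩
  have hF : Continuous F := by
    refine Continuous.subtype_mk (continuous_tubeMap.comp ?_) _
    fun_prop
  have hbij : Function.Bijective F := by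
    constructor
    · rintro ⟨θ, η⟩ ⟨θ', η'⟩ h
      have h' : tubeMap n m (θ, η, r) = tubeMap n m (θ', η', r) := congrArg Subtype.val h
      have hθ := norm_eq_of_mem_sphere θ
      have hθ' := norm_eq_of_mem_sphere θ'
      have hη := norm_eq_of_mem_sphere η
      have hη' := norm_eq_of_mem_sphere η'
      obtain ⟨hpos, hn1⟩ := norm_tubeMap_fst (n := n) hθ hη hr hr1
      obtain ⟨-, hn2⟩ := norm_tubeMap_fst (n := n) hθ' hη' hr hr1
      rw [h', hn2] at hn1
      have h0 : η'.1 0 = η.1 0 := by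
        have : r * η'.1 0 = r * η.1 0 := by linarith
        exact mul_left_cancel₀ hr.ne' this
      have hfst : (1 + r * η.1 0) • θ.1 = (1 + r * η'.1 0) • θ'.1 :=
        congrArg WithLp.fst h'
      rw [h0] at hfst
      have hsnd : r • (WithLp.toLp 2 (fun i => η.1 i.succ) : EuclideanSpace ℝ (Fin (m + 1)))
          = r • (WithLp.toLp 2 (fun i => η'.1 i.succ) : EuclideanSpace ℝ (Fin (m + 1))) :=
        congrArg WithLp.snd h'
      refine Prod.ext (Subtype.ext (smul_right_injective _ hpos.ne' hfst)) (Subtype.ext ?_)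
      have hsnd' := smul_right_injective _ hr.ne' hsnd
      ext i
      refine Fin.cases h0.symm (fun i => ?_) i
      exact congrArg (fun v : EuclideanSpace ℝ (Fin (m + 1)) => v i) hsnd'
    · rintro ⟨p, hp⟩
      rw [tube_eq hr] at hp
      have hp' : tubeRadius p = r := hp
      obtain ⟨θ, η, hθ, hη, h⟩ := exists_tubeMap_eq (hp'.symm ▸ hr) (hp'.symm ▸ hr1)
      refine ⟨⟨⟨θ, by simpa using hθ⟩, ⟨η, by simpa using hη⟩⟩, Subtype.ext ?_⟩
      rw [hp'] at h
      exact h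
  exact ⟨(Continuous.homeoOfEquivCompactToT2 (f := Equiv.ofBijective F hbij) hF).symm⟩

/-- The punctured tubular neighbourhood of radius `a`. -/
def puncturedTube (n m : ℕ) (a : ℝ) : Set (Space n m) := {p | 0 < tubeRadius p ∧ tubeRadius p < a}

/-- The exterior of the ball of radius `R`. -/
def exterior (n m : ℕ) (R : ℝ) : Set (Space n m) := {p | R < ‖p‖}

theorem one_lt_rank_euclideanSpace {d : ℕ} (hd : 1 < d) :
    1 < Module.rank ℝ (EuclideanSpace ℝ (Fin d)) := by
  rw [← Module.finrank_eq_rank, finrank_euclideanSpace_fin]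
  exact_mod_cast hd

/-- The image of `S^n × S^{m+1} × (0, a)` under `tubeMap`; `n ≥ 1` is needed because `S^0` is
disconnected. -/
theorem isConnected_puncturedTube (hn : 1 ≤ n) {a : ℝ} (ha : 0 < a) (ha1 : a ≤ 1) :
    IsConnected (puncturedTube n m a) := by
  have h1 := isConnected_sphere (one_lt_rank_euclideanSpace (d := n + 1) (by omega))
    (0 : EuclideanSpace ℝ (Fin (n + 1))) zero_le_one
  have h2 := isConnected_sphere (one_lt_rank_euclideanSpace (d := m + 2) (by omega))
    (0 : EuclideanSpace ℝ (Fin (m + 2))) zero_le_one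
  have h := (h1.prod (h2.prod (isConnected_Ioo ha))).image (tubeMap n m)
    continuous_tubeMap.continuousOn
  convert h using 1
  ext p
  constructor
  · rintro ⟨hp0, hpa⟩
    obtain ⟨θ, η, hθ, hη, h⟩ := exists_tubeMap_eq hp0 (hpa.trans_le ha1)
    exact ⟨(θ, η, tubeRadius p), ⟨by simpa using hθ, by simpa using hη, hp0, hpa⟩, h⟩
  · rintro ⟨⟨θ, η, r⟩, ⟨hθ, hη, hr0, hra⟩, rfl⟩
    have h3 := tubeRadius_tubeMap (n := n) (m := m) (by simpa using hθ) (by simpa using hη) hr0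
      (hra.trans_le ha1)
    exact ⟨h3.symm ▸ hr0, h3.symm ▸ hra⟩

theorem isConnected_exterior {R : ℝ} (hR : 0 ≤ R) : IsConnected (exterior n m R) := by
  have hrank : 1 < Module.rank ℝ (Space n m) := by
    rw [← Module.finrank_eq_rank]
    have h := finrank_space (n := n) (m := m)
    have h2 : Module.finrank ℝ (Space n m) = n + m + 2 := by exact_mod_cast h
    rw [h2]
    exact_mod_cast (by omega : 1 < n + m + 2)
  have h1 := isConnected_sphere hrank (0 : Space n m) zero_le_one
  have h := (h1.prod (isConnected_Ioi (a := R))).image (fun z => z.2 • z.1)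
    (by fun_prop)
  convert h using 1
  ext p
  constructor
  · intro hp
    have hp0 : 0 < ‖p‖ := hR.trans_lt hp
    refine ⟨(‖p‖⁻¹ • p, ‖p‖), ⟨?_, hp⟩, ?_⟩
    · simp [norm_smul, hp0.ne']
    · simp [smul_smul, hp0.ne']
  · rintro ⟨⟨v, t⟩, ⟨hv, ht⟩, rfl⟩
    have hv' : ‖v‖ = 1 := by simpa using hv
    have ht' : R < t := ht
    change R < ‖t • v‖
    rw [norm_smul, hv', mul_one]
    exact ht'.trans_le (le_abs_self t)

theorem isOpen_puncturedTube (a : ℝ) : IsOpen (puncturedTube n m a) :=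
  (isOpen_lt continuous_const continuous_tubeRadius).inter
    (isOpen_lt continuous_tubeRadius continuous_const)

theorem isOpen_exterior (R : ℝ) : IsOpen (exterior n m R) :=
  isOpen_lt continuous_const continuous_norm

theorem norm_le_one_add_tubeRadius (p : Space n m) : ‖p‖ ≤ 1 + tubeRadius p := by
  have h1 := (abs_le.1 (abs_norm_fst_sub_one_le p)).2
  have h2 := tubeRadius_sq p
  have h3 := norm_sq_space p
  have h4 := tubeRadius_nonneg p
  refine (pow_le_pow_iff_left₀ (norm_nonneg _) (by linarith) two_ne_zero).1 ?_
  nlinarith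

theorem disjoint_puncturedTube_exterior {a R : ℝ} (ha : a ≤ 1) (hR : 2 ≤ R) :
    Disjoint (puncturedTube n m a) (exterior n m R) := by
  rw [Set.disjoint_left]
  rintro p ⟨-, h1⟩ h2
  have h2' : R < ‖p‖ := h2
  have := norm_le_one_add_tubeRadius p
  linarith

theorem exterior_subset_manifold {R : ℝ} (hR : 2 ≤ R) : exterior n m R ⊆ manifold n m := by
  intro p hp
  have hp' : R < ‖p‖ := hp
  rw [← tubeRadius_pos_iff]
  have := norm_le_one_add_tubeRadius p
  linarith

variable (n m) in
/-- The compact set of points at distance `≥ a` from the removed sphere in the ball of radius `R`. -/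
def compactCore (a R : ℝ) : Set (Space n m) := {p | a ≤ tubeRadius p ∧ ‖p‖ ≤ R}

theorem isCompact_compactCore (a R : ℝ) : IsCompact (compactCore n m a R) := by
  refine (isCompact_closedBall (0 : Space n m) R).of_isClosed_subset ?_ ?_
  · exact (isClosed_le continuous_const continuous_tubeRadius).inter
      (isClosed_le continuous_norm continuous_const)
  · intro p hp
    simpa using hp.2

theorem compactCore_subset {a : ℝ} (ha : 0 < a) (R : ℝ) : compactCore n m a R ⊆ manifold n m :=
  fun _ hp => tubeRadius_pos_iff.1 (ha.trans_le hp.1)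

/-- `compactCore` as an admissible compact subset of the manifold. -/
def core {a : ℝ} (ha : 0 < a) (R : ℝ) :
    {K : Set (Space n m) // IsCompact K ∧ K ⊆ manifold n m} :=
  ⟨compactCore n m a R, isCompact_compactCore a R, compactCore_subset ha R⟩

theorem manifold_diff_compactCore {a R : ℝ} (hR : 2 ≤ R) :
    manifold n m \ compactCore n m a R = puncturedTube n m a ∪ exterior n m R := by
  ext p
  constructor
  · rintro ⟨hp, hK⟩
    by_cases h : tubeRadius p < a
    · exact Or.inl ⟨tubeRadius_pos_iff.2 hp, h⟩
    · refine Or.inr (lt_of_not_ge fun h' => hK ⟨not_lt.1 h, h'⟩)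
  · rintro (hp | hp)
    · exact ⟨tubeRadius_pos_iff.1 hp.1, fun h => absurd hp.2 (not_lt.2 h.1)⟩
    · exact ⟨exterior_subset_manifold hR hp, fun h => absurd hp (not_lt.2 h.2)⟩

theorem exists_end_tube (hn : 1 ≤ n) :
    ∃ e : SpaceEnd (manifold n m), ∀ K, ∃ a : ℝ, 0 < a ∧ a ≤ 1 ∧ puncturedTube n m a ⊆ e.comp K := by
  refine (SpaceEnd.exists_of_antitone (Ω := manifold n m)
    (A := fun j : ℕ => puncturedTube n m (1 / ((j : ℝ) + 1))) ?_ ?_ ?_).imp fun e he K => ?_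
  · intro i j hij p hp
    exact ⟨hp.1, hp.2.trans_le (Nat.one_div_le_one_div hij)⟩
  · intro j
    refine isConnected_puncturedTube hn (by positivity) ?_
    rw [div_le_one (by positivity)]
    linarith [(Nat.cast_nonneg j : (0 : ℝ) ≤ j)]
  · intro K hK hKM
    obtain ⟨δ, hδ, h⟩ : ∃ δ : ℝ, 0 < δ ∧ ∀ p ∈ K, δ ≤ tubeRadius p := by
      rcases K.eq_empty_or_nonempty with rfl | hne
      · exact ⟨1, one_pos, by simp⟩
      · obtain ⟨p, hp, hmin⟩ := hK.exists_isMinOn hne continuous_tubeRadius.continuousOn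
        exact ⟨tubeRadius p, tubeRadius_pos_iff.2 (hKM hp), fun q hq => hmin hq⟩
    obtain ⟨j, hj⟩ := exists_nat_one_div_lt hδ
    exact ⟨j, fun p hp => ⟨tubeRadius_pos_iff.1 hp.1,
      fun hpK => absurd (hp.2.trans hj) (not_lt.2 (h p hpK))⟩⟩
  · obtain ⟨j, hj⟩ := he K
    refine ⟨1 / ((j : ℝ) + 1), by positivity, ?_, hj⟩
    rw [div_le_one (by positivity)]
    linarith [(Nat.cast_nonneg j : (0 : ℝ) ≤ j)]

theorem exists_end_exterior :
    ∃ e : SpaceEnd (manifold n m), ∀ K, ∃ R : ℝ, 2 ≤ R ∧ exterior n m R ⊆ e.comp K := by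
  refine (SpaceEnd.exists_of_antitone (Ω := manifold n m)
    (A := fun j : ℕ => exterior n m ((j : ℝ) + 2)) ?_ ?_ ?_).imp fun e he K => ?_
  · intro i j hij p hp
    have hp' : (j : ℝ) + 2 < ‖p‖ := hp
    have : (i : ℝ) ≤ j := by exact_mod_cast hij
    change (i : ℝ) + 2 < ‖p‖
    linarith
  · exact fun j => isConnected_exterior (by positivity)
  · intro K hK hKM
    obtain ⟨C, hC⟩ := hK.isBounded.exists_norm_le
    obtain ⟨j, hj⟩ := exists_nat_gt C
    refine ⟨j, fun p hp => ⟨exterior_subset_manifold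
      (by linarith [(Nat.cast_nonneg j : (0 : ℝ) ≤ j)]) hp, fun hpK => ?_⟩⟩
    have hp' : (j : ℝ) + 2 < ‖p‖ := hp
    linarith [hC p hpK]
  · obtain ⟨j, hj⟩ := he K
    exact ⟨(j : ℝ) + 2, by linarith [(Nat.cast_nonneg j : (0 : ℝ) ≤ j)], hj⟩

theorem SpaceEnd.comp_core (hn : 1 ≤ n) (e : SpaceEnd (manifold n m)) {a R : ℝ} (ha : 0 < a)
    (ha1 : a ≤ 1) (hR : 2 ≤ R) :
    e.comp (core ha R) = puncturedTube n m a ∨ e.comp (core ha R) = exterior n m R :=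
  e.comp_eq_or_eq _ (isOpen_puncturedTube a) (isOpen_exterior R)
    (disjoint_puncturedTube_exterior ha1 hR) (isConnected_puncturedTube hn ha ha1).isPreconnected
    (isConnected_exterior (by linarith)).isPreconnected (manifold_diff_compactCore hR)

theorem nontrivial_spaceEnd (hn : 1 ≤ n) : Nontrivial (SpaceEnd (manifold n m)) := by
  obtain ⟨e, he⟩ := exists_end_tube (m := m) hn
  obtain ⟨e', he'⟩ := exists_end_exterior (n := n) (m := m)
  refine ⟨e, e', fun heq => ?_⟩
  subst heq
  obtain ⟨a, ha, ha1, hsub⟩ := he (core one_pos 2)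
  obtain ⟨R, hR, hsub'⟩ := he' (core one_pos 2)
  have hdisj := disjoint_puncturedTube_exterior (n := n) (m := m) (le_refl (1 : ℝ)) (le_refl (2 : ℝ))
  obtain ⟨p, hp⟩ := (isConnected_puncturedTube (m := m) hn ha ha1).nonempty
  obtain ⟨q, hq⟩ := (isConnected_exterior (n := n) (m := m) (R := R) (by linarith)).nonempty
  rcases e.comp_core hn one_pos le_rfl le_rfl with h | h
  · exact Set.disjoint_left.1 hdisj (h ▸ hsub' hq) (hR.trans_lt hq)
  · exact Set.disjoint_left.1 hdisj ⟨hp.1, hp.2.trans_le ha1⟩ (h ▸ hsub hp)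

/-- An end is the end at the removed sphere or the end at infinity. -/
theorem SpaceEnd.tube_or_exterior (hn : 1 ≤ n) (e : SpaceEnd (manifold n m)) :
    (∀ {a R : ℝ} (ha : 0 < a), a ≤ 1 → 2 ≤ R → e.comp (core ha R) = puncturedTube n m a) ∨
    (∀ {a R : ℝ} (ha : 0 < a), a ≤ 1 → 2 ≤ R → e.comp (core ha R) = exterior n m R) := by
  -- The choice made at the core with `a = 1`, `R = 2` decides the end: larger cores have smaller
  -- components, which cannot jump to the other, disjoint piece.
  have hmono : ∀ {a R : ℝ} (ha : 0 < a), a ≤ 1 → 2 ≤ R →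
      e.comp (core ha R) ⊆ e.comp (core one_pos 2) := fun ha ha1 hR =>
    e.anti _ _ fun p hp => ⟨ha1.trans hp.1, hp.2.trans hR⟩
  have hdisj := disjoint_puncturedTube_exterior (n := n) (m := m) (le_refl (1 : ℝ)) (le_refl (2 : ℝ))
  rcases e.comp_core hn one_pos le_rfl le_rfl with h | h
  · refine Or.inl fun {a R} ha ha1 hR => (e.comp_core hn ha ha1 hR).resolve_right fun h' => ?_
    obtain ⟨q, hq⟩ := (isConnected_exterior (n := n) (m := m) (R := R) (by linarith)).nonempty
    exact Set.disjoint_left.1 hdisj (h ▸ hmono ha ha1 hR (h' ▸ hq)) (hR.trans_lt hq)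
  · refine Or.inr fun {a R} ha ha1 hR => (e.comp_core hn ha ha1 hR).resolve_left fun h' => ?_
    obtain ⟨p, hp⟩ := (isConnected_puncturedTube (m := m) hn ha ha1).nonempty
    exact Set.disjoint_left.1 hdisj ⟨hp.1, hp.2.trans_le ha1⟩ (h ▸ hmono ha ha1 hR (h' ▸ hp))

end TubeTopology

/-! ### Positive foliations of the two ends. -/

section PositiveHypersurfaces

variable {n m : ℕ}

theorem isOpen_fst_ne_zero : IsOpen {p : Space n m | p.fst ≠ 0} :=
  isOpen_ne_fun (by fun_prop) continuous_const

theorem contDiffOn_tubeRadius_sq (c : ℝ) :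
    ContDiffOn ℝ ∞ (fun p : Space n m => (c - tubeRadius p ^ 2) / 2) {p | p.fst ≠ 0} := by
  have hfst : ContDiff ℝ ∞ fun p : Space n m => p.fst :=
    (WithLp.fstL 2 ℝ (EuclideanSpace ℝ (Fin (n + 1))) (EuclideanSpace ℝ (Fin (m + 1)))).contDiff
  have hsnd : ContDiff ℝ ∞ fun p : Space n m => p.snd :=
    (WithLp.sndL 2 ℝ (EuclideanSpace ℝ (Fin (n + 1))) (EuclideanSpace ℝ (Fin (m + 1)))).contDiff
  simp only [tubeRadius_sq]
  exact (contDiffOn_const.sub ((((hfst.contDiffOn.norm ℝ fun p hp => hp).sub contDiffOn_const).pow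
    2).add (hsnd.norm_sq ℝ).contDiffOn)).div_const 2

theorem fderiv_tubeRadius_sq_ne_zero {p : Space n m} (hx : p.fst ≠ 0) (hp : p ∈ manifold n m)
    (c : ℝ) : fderiv ℝ (fun p : Space n m => (c - tubeRadius p ^ 2) / 2) p ≠ 0 := by
  refine fderiv_ne_zero_of_innerForm (hasFDerivAt_tubeRadius_sq hx c) (neg_ne_zero.2 fun h => ?_)
  have h1 := norm_tubeField_sq hx
  rw [h, norm_zero] at h1
  have h2 := tubeRadius_pos_iff.2 hp
  nlinarith

theorem isCompact_tubeRadius_eq (r : ℝ) : IsCompact {p : Space n m | tubeRadius p = r} := by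
  refine (isCompact_compactCore r (1 + r)).of_isClosed_subset
    (isClosed_eq continuous_tubeRadius continuous_const) fun p hp => ?_
  have hp' : tubeRadius p = r := hp
  exact ⟨hp'.ge, hp' ▸ norm_le_one_add_tubeRadius p⟩

/-- The inner region `D` is left open because it occurs both as `tubeInside` and as a superlevel set
of the foliating function. -/
theorem isPositiveHypersurface_tubeRadius {g : Space n m → Space n m →L[ℝ] Space n m →L[ℝ] ℝ}
    {r : ℝ} (hr : 0 < r) (hr1 : r < 1) {D : Set (Space n m)}
    (hD : ∀ q ∈ manifold n m, q.fst ≠ 0 → (q ∈ D ↔ tubeRadius q < r))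
    (hpos : ∀ p : Space n m, tubeRadius p = r →
      0 < meanCurvature g (fun p => (r ^ 2 - tubeRadius p ^ 2) / 2) p) :
    IsPositiveHypersurface g (manifold n m) {p | tubeRadius p = r} D where
  subset p hp := tubeRadius_pos_iff.1 (hr.trans_eq (Eq.symm hp))
  isCompact := isCompact_tubeRadius_eq r
  positive p hp := by
    have hp' : tubeRadius p = r := hp
    refine ⟨{q | q.fst ≠ 0} ∩ manifold n m, fun p => (r ^ 2 - tubeRadius p ^ 2) / 2,
      isOpen_fst_ne_zero.inter isOpen_manifold,
      ⟨fst_ne_zero_of_tubeRadius_lt (hp'.trans_lt hr1), tubeRadius_pos_iff.1 (hr.trans_eq hp'.symm)⟩,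
      (contDiffOn_tubeRadius_sq _).mono Set.inter_subset_left,
      fun q hq => fderiv_tubeRadius_sq_ne_zero hq.1 hq.2 _, fun q _ => ?_, fun q hq => ?_,
      hpos p hp⟩
    · have hq0 := tubeRadius_nonneg q
      rw [div_eq_zero_iff, or_iff_left two_ne_zero, sub_eq_zero,
        pow_left_inj₀ hr.le hq0 two_ne_zero]
      exact eq_comm
    · have hq0 := tubeRadius_nonneg q
      rw [hD q hq.2 hq.1, div_pos_iff_of_pos_right two_pos, sub_pos,
        pow_lt_pow_iff_left₀ hq0 hr.le two_ne_zero]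

/-- The nearest point is `(x/|x|, 0)`, and the reverse triangle inequality shows that no other is
closer. -/
theorem infDist_removedSphere {p : Space n m} (hx : p.fst ≠ 0) :
    Metric.infDist p (removedSphere n m) = tubeRadius p := by
  have hs : 0 < ‖p.fst‖ := norm_pos_iff.2 hx
  have he : ‖‖p.fst‖⁻¹ • p.fst‖ = 1 := by
    rw [norm_smul, norm_inv, norm_norm, inv_mul_cancel₀ hs.ne']
  have hmem : equatorial n m (‖p.fst‖⁻¹ • p.fst) ∈ removedSphere n m := ⟨he, rfl⟩
  refine le_antisymm ?_ ((Metric.le_infDist ⟨_, hmem⟩).2 fun q hq => ?_)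
  · refine (Metric.infDist_le_dist_of_mem hmem).trans_eq ?_
    rw [dist_eq_norm]
    have h := sub_equatorial_norm_sq hx he
    rw [sub_self, norm_zero] at h
    exact (pow_left_inj₀ (norm_nonneg _) (tubeRadius_nonneg p) two_ne_zero).1 (by linarith)
  · rw [dist_eq_norm]
    refine (pow_le_pow_iff_left₀ (tubeRadius_nonneg p) (norm_nonneg _) two_ne_zero).1 ?_
    rw [norm_sq_space, tubeRadius_sq, WithLp.sub_fst, WithLp.sub_snd, hq.2, sub_zero]
    have h := abs_norm_sub_norm_le p.fst q.fst
    rw [hq.1] at h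
    have h2 : (‖p.fst‖ - 1) ^ 2 ≤ ‖p.fst - q.fst‖ ^ 2 := by
      rw [← sq_abs]
      gcongr
    linarith

theorem isPositiveHypersurface_sphere {g : Space n m → Space n m →L[ℝ] Space n m →L[ℝ] ℝ}
    {R : ℝ} (hR : 2 ≤ R)
    (hpos : ∀ p : Space n m, ‖p‖ = R → 0 < meanCurvature g (fun p => (‖p‖ ^ 2 - R ^ 2) / 2) p) :
    IsPositiveHypersurface g (manifold n m) (Metric.sphere (0 : Space n m) R) {p | R < ‖p‖} where
  subset p hp := by
    have hp' : ‖p‖ = R := by simpa using hp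
    have := norm_le_one_add_tubeRadius p
    exact tubeRadius_pos_iff.1 (by linarith)
  isCompact := isCompact_sphere _ _
  positive p hp := by
    have hp' : ‖p‖ = R := by simpa using hp
    refine ⟨{q | q ≠ 0}, fun p => (‖p‖ ^ 2 - R ^ 2) / 2, isOpen_ne, ?_,
      (((contDiff_id.norm_sq ℝ).sub contDiff_const).div_const 2).contDiffOn, fun q hq => ?_,
      fun q _ => ?_, fun q _ => ?_, hpos p hp'⟩
    · rintro rfl
      rw [norm_zero] at hp'
      linarith
    · exact fderiv_norm_sq_ne_zero hq _
    · rw [mem_sphere_zero_iff_norm, div_eq_zero_iff, or_iff_left two_ne_zero, sub_eq_zero,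
        pow_left_inj₀ (norm_nonneg _) (by linarith) two_ne_zero]
    · rw [Set.mem_ofPred_eq, div_pos_iff_of_pos_right two_pos, sub_pos,
        pow_lt_pow_iff_left₀ (by linarith) (norm_nonneg _) two_ne_zero]

/-- The end at the removed sphere is positive if thin tubes have positive mean curvature. -/
theorem SpaceEnd.isPositive_of_tube {g : Space n m → Space n m →L[ℝ] Space n m →L[ℝ] ℝ}
    {e : SpaceEnd (manifold n m)} {a : ℝ} (ha : 0 < a) (ha1 : a ≤ 1)
    (he : ∀ {r : ℝ} (hr : 0 < r), r ≤ 1 → e.comp (core hr 2) = puncturedTube n m r)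
    (hpos : ∀ p ∈ puncturedTube n m a, ∀ c : ℝ,
      0 < meanCurvature g (fun p => (c - tubeRadius p ^ 2) / 2) p) : e.IsPositive g := by
  have hx : ∀ p ∈ puncturedTube n m a, p.fst ≠ 0 ∧ p ∈ manifold n m := fun p hp =>
    ⟨fst_ne_zero_of_tubeRadius_lt (hp.2.trans_le ha1), tubeRadius_pos_iff.1 hp.1⟩
  refine ⟨puncturedTube n m a, fun p => (0 - tubeRadius p ^ 2) / 2, isOpen_puncturedTube a,
    fun p hp => (hx p hp).2, ⟨core ha 2, (he ha ha1).le⟩,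
    (contDiffOn_tubeRadius_sq 0).mono fun p hp => (hx p hp).1,
    fun p hp => fderiv_tubeRadius_sq_ne_zero (hx p hp).1 (hx p hp).2 0, ?_⟩
  rintro _ ⟨p₀, hp₀, rfl⟩
  set r := tubeRadius p₀ with hr
  have hr0 : 0 < r := hp₀.1
  have hra : r < a := hp₀.2
  have hlt : ∀ q : Space n m, (0 - r ^ 2) / 2 < (0 - tubeRadius q ^ 2) / 2 ↔ tubeRadius q < r := by
    intro q
    rw [div_lt_div_iff_of_pos_right two_pos, sub_lt_sub_iff_left,
      pow_lt_pow_iff_left₀ (tubeRadius_nonneg q) hr0.le two_ne_zero]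
  have heq : ∀ q : Space n m, (0 - tubeRadius q ^ 2) / 2 = (0 - r ^ 2) / 2 ↔ tubeRadius q = r := by
    intro q
    rw [div_left_inj' two_ne_zero, sub_right_inj,
      pow_left_inj₀ (tubeRadius_nonneg q) hr0.le two_ne_zero]
  have hleaf : {p | p ∈ puncturedTube n m a ∧ (0 - tubeRadius p ^ 2) / 2 = (0 - r ^ 2) / 2}
      = {p : Space n m | tubeRadius p = r} := by
    ext q
    rw [Set.mem_ofPred_eq, heq, Set.mem_ofPred_eq]
    exact ⟨fun h => h.2, fun h => ⟨⟨hr0.trans_eq h.symm, h.trans_lt hra⟩, h⟩⟩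
  refine ⟨⟨core hr0 2, ?_⟩, ?_⟩
  · rw [he hr0 (hra.le.trans ha1)]
    exact fun q hq => ⟨⟨hq.1, hq.2.trans hra⟩, (hlt q).2 hq.2⟩
  · rw [hleaf]
    refine isPositiveHypersurface_tubeRadius hr0 (hra.trans_le ha1) (fun q hq _ => ?_)
      fun q hq => hpos q ⟨hr0.trans_eq hq.symm, hq.trans_lt hra⟩ _
    rw [Set.mem_ofPred_eq, hlt]
    exact ⟨fun h => h.2, fun h => ⟨⟨tubeRadius_pos_iff.2 hq, h.trans hra⟩, h⟩⟩

/-- The end at infinity is positive if large spheres have positive mean curvature. -/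
theorem SpaceEnd.isPositive_of_exterior {g : Space n m → Space n m →L[ℝ] Space n m →L[ℝ] ℝ}
    {e : SpaceEnd (manifold n m)} {R₁ : ℝ} (hR₁ : 2 ≤ R₁)
    (he : ∀ {R : ℝ}, 2 ≤ R → e.comp (core one_pos R) = exterior n m R)
    (hpos : ∀ p ∈ exterior n m R₁, ∀ c : ℝ,
      0 < meanCurvature g (fun p => (‖p‖ ^ 2 - c) / 2) p) : e.IsPositive g := by
  refine ⟨exterior n m R₁, fun p => (‖p‖ ^ 2 - 0) / 2, isOpen_exterior R₁,
    exterior_subset_manifold hR₁, ⟨core one_pos R₁, (he hR₁).le⟩,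
    (((contDiff_id.norm_sq ℝ).sub contDiff_const).div_const 2).contDiffOn, fun p hp => ?_, ?_⟩
  · have hp' : R₁ < ‖p‖ := hp
    exact fderiv_norm_sq_ne_zero (norm_pos_iff.1 (by linarith)) _
  rintro _ ⟨p₀, hp₀, rfl⟩
  set R := ‖p₀‖ with hR
  have hRR : R₁ < R := hp₀
  have hR0 : 0 ≤ R := by linarith
  have hlt : ∀ q : Space n m, (R ^ 2 - 0) / 2 < (‖q‖ ^ 2 - 0) / 2 ↔ R < ‖q‖ := by
    intro q
    rw [div_lt_div_iff_of_pos_right two_pos, sub_lt_sub_iff_right,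
      pow_lt_pow_iff_left₀ hR0 (norm_nonneg q) two_ne_zero]
  have heq : ∀ q : Space n m, (‖q‖ ^ 2 - 0) / 2 = (R ^ 2 - 0) / 2 ↔ ‖q‖ = R := by
    intro q
    rw [div_left_inj' two_ne_zero, sub_left_inj,
      pow_left_inj₀ (norm_nonneg q) hR0 two_ne_zero]
  have hleaf : {p | p ∈ exterior n m R₁ ∧ (‖p‖ ^ 2 - 0) / 2 = (R ^ 2 - 0) / 2}
      = Metric.sphere (0 : Space n m) R := by
    ext q
    rw [Set.mem_ofPred_eq, heq, mem_sphere_zero_iff_norm]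
    exact ⟨fun h => h.2, fun h => ⟨hRR.trans_eq h.symm, h⟩⟩
  have hside : {p | p ∈ exterior n m R₁ ∧ (R ^ 2 - 0) / 2 < (‖p‖ ^ 2 - 0) / 2}
      = {p : Space n m | R < ‖p‖} := by
    ext q
    rw [Set.mem_ofPred_eq, hlt, Set.mem_ofPred_eq]
    exact ⟨fun h => h.2, fun h => ⟨hRR.trans h, h⟩⟩
  rw [hleaf, hside]
  refine ⟨⟨core one_pos R, (he (by linarith)).le⟩, ?_⟩
  exact isPositiveHypersurface_sphere (by linarith) fun q hq => hpos q (hRR.trans_eq hq.symm) _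

theorem hasPositiveEnds_metric (hn : 1 ≤ n) (hm : 1 ≤ m) {w ε : ℝ} (hw : 0 < w) (hε : 0 < ε) :
    HasPositiveEnds (manifold n m) (metric n m w ε) := by
  refine ⟨nontrivial_spaceEnd hn, fun e => ?_⟩
  rcases e.tube_or_exterior hn with he | he
  · have hC := mul_pos hw (tubeConstant_pos hn hm)
    obtain ⟨δ, hδ, hδ1, h⟩ := exists_meanCurvature_tube_pos hw hn hm (half_lt_self hC)
    have hθ : 0 < w * tubeConstant n m / 2 * ε := by positivity
    -- Here `θ = w C / 2`. For `r < 1` and `m ≥ 1`, `r^m ≤ r < θ ε`, so every `ε > 0` is admissible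
    -- with a thin enough tube.
    refine SpaceEnd.isPositive_of_tube (a := min δ (w * tubeConstant n m / 2 * ε))
      (lt_min hδ hθ) ((min_le_left _ _).trans hδ1.le) (fun hr hr1 => he hr hr1 le_rfl)
      fun p hp c => ?_
    have h1 : tubeRadius p < δ := hp.2.trans_le (min_le_left _ _)
    have h2 : tubeRadius p < w * tubeConstant n m / 2 * ε := hp.2.trans_le (min_le_right _ _)
    refine h ε hε p (tubeRadius_pos_iff.1 hp.1) h1 (lt_of_le_of_lt ?_ h2) c
    exact pow_le_of_le_one hp.1.le (h1.le.trans hδ1.le) (by omega)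
  · have hS : 0 ≤ 4 * ε * w * (surfaceMeasure n).real Set.univ := by positivity
    refine SpaceEnd.isPositive_of_exterior
      (R₁ := 2 + 4 * ε * w * (surfaceMeasure n).real Set.univ) (by linarith)
      (fun hR => he one_pos le_rfl hR) fun p hp c => ?_
    have hp' : 2 + 4 * ε * w * (surfaceMeasure n).real Set.univ < ‖p‖ := hp
    exact meanCurvature_sphere_pos hw hε hn (by linarith) (by linarith) c

end PositiveHypersurfaces

end PositiveEnds

end

open PositiveEnds in
theorem mainTheorem9 (n m : ℕ) (hn : 1 ≤ n) (hm : 1 ≤ m) (w : ℝ) (hw : 0 < w) :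
    (∀ ε : ℝ, 0 < ε →
      PositiveEnds.IsRiemannianMetricOn (PositiveEnds.metric n m w ε)
        (PositiveEnds.manifold n m) ∧
      PositiveEnds.HasPositiveEnds (PositiveEnds.manifold n m)
        (PositiveEnds.metric n m w ε)) ∧
    (∀ θ : ℝ, 0 < θ → θ < w * PositiveEnds.tubeConstant n m →
      ∃ ε₀ : ℝ, 0 < ε₀ ∧ ∀ ε : ℝ, 0 < ε → ε < ε₀ →
        ∀ r : ℝ, 0 < r → r < (θ * ε) ^ (1 / (m : ℝ)) →
          Nonempty (PositiveEnds.tube n m r ≃ₜ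
            Metric.sphere (0 : EuclideanSpace ℝ (Fin (n + 1))) 1 ×
              Metric.sphere (0 : EuclideanSpace ℝ (Fin (m + 2))) 1) ∧
          PositiveEnds.IsPositiveHypersurface (PositiveEnds.metric n m w ε)
            (PositiveEnds.manifold n m) (PositiveEnds.tube n m r)
            (PositiveEnds.tubeInside n m r)) ∧
    (∃ R₀ : ℝ, ∃ ε₀ : ℝ, 0 < ε₀ ∧ ∀ ε : ℝ, 0 < ε → ε < ε₀ → ∀ R : ℝ, R₀ < R →
      PositiveEnds.IsPositiveHypersurface (PositiveEnds.metric n m w ε)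
        (PositiveEnds.manifold n m) (Metric.sphere (0 : PositiveEnds.Space n m) R)
        {p : PositiveEnds.Space n m | R < ‖p‖}) := by
  refine ⟨fun ε hε => ⟨isRiemannianMetricOn_metric hw hε, hasPositiveEnds_metric hn hm hw hε⟩,
    fun θ hθ hθC => ?_, ?_⟩
  · obtain ⟨δ, hδ, hδ1, h⟩ := exists_meanCurvature_tube_pos hw hn hm hθC
    -- Then `r^m < θ ε < δ^m`, so the radius condition is automatic.
    refine ⟨δ ^ m / θ, by positivity, fun ε hε hεδ r hr hrθ => ?_⟩
    rw [lt_div_iff₀ hθ] at hεδ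
    have hm0 : (m : ℝ) ≠ 0 := by positivity
    have hrm : r ^ m < θ * ε := by
      have h1 := pow_lt_pow_left₀ hrθ hr.le (by omega : m ≠ 0)
      rwa [← Real.rpow_natCast ((θ * ε) ^ (1 / (m : ℝ))), ← Real.rpow_mul (by positivity),
        one_div_mul_cancel hm0, Real.rpow_one] at h1
    have hrδ : r < δ := by
      refine (pow_lt_pow_iff_left₀ hr.le hδ.le (by omega : m ≠ 0)).1 ?_
      linarith
    have hr1 : r < 1 := hrδ.trans hδ1
    refine ⟨nonempty_tube_homeomorph hr hr1, ?_⟩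
    rw [tube_eq hr]
    refine isPositiveHypersurface_tubeRadius hr hr1 (fun q hq hx => ?_) fun p hp => ?_
    · rw [tubeInside, Set.mem_ofPred_eq, infDist_removedSphere hx, and_iff_right hq]
    · exact h ε hε p (tubeRadius_pos_iff.1 (hr.trans_eq hp.symm)) (hp.trans_lt hrδ)
        (by rwa [hp]) _
  · have hS : 0 ≤ (surfaceMeasure n).real Set.univ := MeasureTheory.measureReal_nonneg
    -- This gives `4 ε w |S^n| < 1 < R - 1`; the added `1` in the denominator avoids proving that
    -- the total mass is nonzero.
    refine ⟨2, 1 / (4 * w * (surfaceMeasure n).real Set.univ + 1), by positivity,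
      fun ε hε hεlt R hR => isPositiveHypersurface_sphere hR.le fun p hp => ?_⟩
    rw [lt_div_iff₀ (by positivity)] at hεlt
    refine meanCurvature_sphere_pos hw hε hn (by linarith) ?_ _
    rw [hp]
    linarith
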